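/- **Theorem (Law Characterization, Wiener space).** Let $\mathfrak{H}$ be a real separable Hilbert space and $W=\{W(h):h\in\mathfrak{H}\}$ an isonormal Gaussian process over $\mathfrak{H}$ on a probability space $(\Omega,\mathcal{F},\mathbb{P})$, i.e. a centered Gaussian family with $\mathbb{E}[W(h_1)W(h_2)]=\langle h_1,h_2\rangle_{\mathfrak{H}}$. Let $D$ be the Malliavin derivative, with domain $\mathbb{D}^{1,2}\subset L^2(\Omega)$, and let $L^{-1}F=-\sum_{q\ge1}\frac1q J_qF$, where $J_q$ is the orthogonal projection onto the $q$-th Wiener chaos. For $F\in\mathbb{D}^{1,2}$ put $$g_F=\mathbb{E}\left[\langle DF,-DL^{-1}F\rangle_{\mathfrak{H}}\,\middle|\,F\right].$$ Let $X,Z\in\mathbb{D}^{1,2}$ have mean $0$. Assume that the law of $Z$ has support $(l,u)$ with $-\infty\le l<0<u\le\infty$ (that is, its topological support is the closure of $(l,u)$ in $\mathbb{R}$) and a density $\rho_*$ that is continuous on $(l,u)$. Define $$g_*(z)=\frac{1}{\rho_*(z)}\int_z^u y\,\rho_*(y)\,dy\quad\text{for } z\in(l,u),\qquad g_*(z)=0\quad\text{for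 } z\notin(l,u),$$ and let $G_*$ be an antiderivative of $g_*$ on $\mathbb{R}$ (i.e. $g_*$ is locally integrable and $G_*(b)-G_*(a)=\int_a^b g_*(y)\,dy$ for all $a,b\in\mathbb{R}$). Assume further: * $g_*$ is bounded, or $X$ has a density; * there is a positive $\tilde g\in\mathcal{C}^1(l,u)$ such that $0<\liminf g_*/\tilde g\le\limsup g_*/\tilde g<\infty$ as $x\to u^-$ and as $x\to l^+$, and the limits $\tilde g'(l^+)$ and $\tilde g'(u^-)$ exist in $[-\infty,\infty]$; * if $u=\infty$ then $\liminf_{x\to\infty}g_*(x)>0$, and if $l=-\infty$ then $\liminf_{x\to-\infty}g_*(x)>0$; * $\mathbb{E}[g_*(Z)^2]<\infty$. Then $X$ and $Z$ have the same law if and only if all of the following hold (each including that the expectation on its left-hand side exists and is finite): 1. $\mathbb{E}[g_*(X)^2]=\mathbb{E}[g_*(Z)^2]$; 2. $\mathbb{E}[X\,G_*(X)]=\mathbb{E}[Z\,G_*(Z)]$; 3. $\mathbb{E}[g_X^2]=\mathbb{E}[g_Z^2]$. -/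

import Mathlib

open MeasureTheory ProbabilityTheory Filter Topology

/-- `W` is an isonormal Gaussian process over the Hilbert space `H`: a centered Gaussian family
indexed by `H` with `E[W(h₁) W(h₂)] = ⟪h₁, h₂⟫`. -/
structure IsIsonormal {Ω H : Type*} [MeasurableSpace Ω] [NormedAddCommGroup H]
    [InnerProductSpace ℝ H] (W : H → Ω → ℝ) (P : Measure Ω) : Prop where
  gaussian : IsGaussianProcess W P
  centered : ∀ h, ∫ ω, W h ω ∂P = 0
  covariance : ∀ h₁ h₂, ∫ ω, W h₁ ω * W h₂ ω ∂P = inner ℝ h₁ h₂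

section Malliavin

variable {Ω H : Type*} [MeasurableSpace Ω] [NormedAddCommGroup H] [InnerProductSpace ℝ H]

/-- The graph of the derivative on smooth random variables: the pairs `(F, DF)` with
`F = f(W(h₁), …, W(hₙ))` and `DF = ∑ᵢ ∂ᵢf(W(h₁), …, W(hₙ)) hᵢ`, where `f` is smooth and `f` and
all its partial derivatives have polynomial growth. -/
def smoothGraph (W : H → Ω → ℝ) (P : Measure Ω) : Set (Lp ℝ 2 P × Lp H 2 P) :=
  {p | ∃ (n : ℕ) (h : Fin n → H) (f : (Fin n → ℝ) → ℝ), Function.HasTemperateGrowth f ∧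
    (p.1 =ᵐ[P] fun ω => f (fun i => W (h i) ω)) ∧
    (p.2 =ᵐ[P] fun ω => ∑ i, fderiv ℝ f (fun j => W (h j) ω) (Pi.single i 1) • h i)}

/-- The graph of the Malliavin derivative, i.e. of the closure in `L²(Ω) × L²(Ω; H)` of the
derivative on smooth random variables. -/
def malliavinGraph (W : H → Ω → ℝ) (P : Measure Ω) : Set (Lp ℝ 2 P × Lp H 2 P) :=
  closure (smoothGraph W P)

/-- The space `𝔻^{1,2}`, the domain of the Malliavin derivative. -/
def malliavinDomain (W : H → Ω → ℝ) (P : Measure Ω) : Set (Lp ℝ 2 P) :=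
  {F | ∃ U, (F, U) ∈ malliavinGraph W P}

open Classical in
/-- The Malliavin derivative `D : 𝔻^{1,2} → L²(Ω; H)` (extended by `0` outside its domain). For an
isonormal process the derivative on smooth random variables is closable, so that `U` with
`(F, U)` in the graph is unique. -/
noncomputable def malliavinDeriv (W : H → Ω → ℝ) (P : Measure Ω) (F : Lp ℝ 2 P) : Lp H 2 P :=
  if hF : ∃ U, (F, U) ∈ malliavinGraph W P then hF.choose else 0

/-- The `q`-th Wiener chaos: the closed subspace of `L²(Ω)` generated by `H_q(W(h))`, `‖h‖ = 1`,
with `H_q` the `q`-th (probabilists') Hermite polynomial. -/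
noncomputable def wienerChaos (W : H → Ω → ℝ) (P : Measure Ω) (q : ℕ) :
    Submodule ℝ (Lp ℝ 2 P) :=
  (Submodule.span ℝ {F : Lp ℝ 2 P | ∃ h : H, ‖h‖ = 1 ∧
    F =ᵐ[P] fun ω => Polynomial.aeval (W h ω) (Polynomial.hermite q)}).topologicalClosure

instance wienerChaos_completeSpace (W : H → Ω → ℝ) (P : Measure Ω) (q : ℕ) : CompleteSpace (wienerChaos W P q) :=
  (Submodule.isClosed_topologicalClosure _).completeSpace_coe

/-- The orthogonal projection of `L²(Ω)` onto the `q`-th Wiener chaos. -/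
noncomputable def chaosProj (W : H → Ω → ℝ) (P : Measure Ω) (q : ℕ) (F : Lp ℝ 2 P) : Lp ℝ 2 P :=
  (wienerChaos W P q).starProjection F

/-- The pseudo-inverse `L⁻¹ F = -∑_{q ≥ 1} (1/q) J_q F` of the generator `L` of the
Ornstein-Uhlenbeck semigroup, `J_q` being the projection onto the `q`-th chaos. -/
noncomputable def pseudoInvL (W : H → Ω → ℝ) (P : Measure Ω) (F : Lp ℝ 2 P) : Lp ℝ 2 P :=
  -∑' q : ℕ, (1 / ((q : ℝ) + 1)) • chaosProj W P (q + 1) F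

/-- The random variable `g_F = E[⟪DF, -D L⁻¹ F⟫ | F]`. -/
noncomputable def gRV (W : H → Ω → ℝ) (P : Measure Ω) (F : Lp ℝ 2 P) : Ω → ℝ :=
  P[fun ω => inner ℝ (malliavinDeriv W P F ω) (-(malliavinDeriv W P (pseudoInvL W P F) ω)) |
    MeasurableSpace.comap F inferInstance]

end Malliavin

/-- The open interval `(l, u)` of real numbers with endpoints in `[-∞, ∞]`. -/
def realIoo (l u : EReal) : Set ℝ := {x | l < (x : EReal) ∧ (x : EReal) < u}

/-- The function `g_*` of a density `ρ` on `(l, u)`: `g_*(z) = (∫_z^u y ρ(y) dy) / ρ(z)` for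
`z ∈ (l, u)` and `g_*(z) = 0` otherwise. -/
noncomputable def gStar (ρ : ℝ → ℝ) (l u : EReal) : ℝ → ℝ :=
  (realIoo l u).indicator fun z => (∫ y in realIoo (z : EReal) u, y * ρ y) / ρ z

/-- `G` is an antiderivative of the locally integrable function `g`. -/
def IsAntideriv (G g : ℝ → ℝ) : Prop :=
  ∀ a b : ℝ, IntervalIntegrable g volume a b ∧ ∫ x in a..b, g x = G b - G a

/-- `x → u` from the left, through real numbers (`u = ∞` is allowed). -/
noncomputable def leftOf (u : EReal) : Filter ℝ := comap Real.toEReal (𝓝[<] u)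

/-- `x → l` from the right, through real numbers (`l = -∞` is allowed). -/
noncomputable def rightOf (l : EReal) : Filter ℝ := comap Real.toEReal (𝓝[>] l)

/-- The law `ν` of the target variable has support `(l, u)`, `-∞ ≤ l < 0 < u ≤ ∞`, and density `ρ`
with respect to Lebesgue measure, and `ρ` is continuous on `(l, u)`. -/
structure IsTargetLaw (ν : Measure ℝ) (l u : EReal) (ρ : ℝ → ℝ) : Prop where
  left_neg : l < 0
  right_pos : 0 < u
  support_eq : ν.support = closure (realIoo l u)
  measurable_density : Measurable ρ
  density_nonneg : ∀ x, 0 ≤ ρ x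
  law_eq : ν = volume.withDensity fun x => ENNReal.ofReal (ρ x)
  continuousOn_density : ContinuousOn ρ (realIoo l u)

/-- The endpoint condition on a function `g` on `(l, u)`: near each endpoint `g` is comparable with
a positive `C¹` function on `(l, u)` whose derivative has a limit in `[-∞, ∞]` there, and `g` is
bounded away from `0` near each infinite endpoint. -/
structure EndpointCondition (g : ℝ → ℝ) (l u : EReal) : Prop where
  comparison : ∃ gt : ℝ → ℝ, ContDiffOn ℝ 1 gt (realIoo l u) ∧ (∀ x ∈ realIoo l u, 0 < gt x) ∧
    (0 < liminf (fun x => ((g x / gt x : ℝ) : EReal)) (leftOf u) ∧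
      limsup (fun x => ((g x / gt x : ℝ) : EReal)) (leftOf u) < ⊤) ∧
    (0 < liminf (fun x => ((g x / gt x : ℝ) : EReal)) (rightOf l) ∧
      limsup (fun x => ((g x / gt x : ℝ) : EReal)) (rightOf l) < ⊤) ∧
    (∃ a : EReal, Tendsto (fun x => ((deriv gt x : ℝ) : EReal)) (rightOf l) (𝓝 a)) ∧
    (∃ b : EReal, Tendsto (fun x => ((deriv gt x : ℝ) : EReal)) (leftOf u) (𝓝 b))
  right_infinite : u = ⊤ → 0 < liminf (fun x => (g x : EReal)) (leftOf u)
  left_infinite : l = ⊥ → 0 < liminf (fun x => (g x : EReal)) (rightOf l)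

/-! For a centered square-integrable law `μ` of `X` put m(y) = E[X 1_{X ≥ y}] (`steinMass`). By
Fubini, E[X (φ(X) - φ(0))] = ∫ φ'(y) m(y) dy for φ' ≥ 0. A Stein kernel is thus a function γ ≥ 0
with γ·μ = m dy, and it satisfies E[γ(X) φ'(X)] = E[X φ(X)] when these expectations exist.

Malliavin calculus provides the kernel: g_F = γ(F) almost surely (`exists_isSteinKernel`). Gaussian
integration by parts shows that D is closable and that the q-th chaos lies in the eigenspace of D*D
for q. Hence -L⁻¹F is in the domain of D and ⟪DG, -DL⁻¹F⟫ = ⟪G, F⟫ in L² for G in the domain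
(`exists_deriv_pseudoInvL`). With G = h(F), the chain rule and conditioning on F, this becomes
Stein's identity. Trigonometric h' suffice, since characteristic functions determine finite
measures; the sign of γ then follows from m ≥ 0.

For the target law m/ρ = g_*, so its kernel is g_* almost everywhere (`IsTargetLaw.kernel_eq`). For
X with kernel γ, E[(γ(X) - g_*(X))²] = E[g_X²] + E[g_*(X)²] - 2 E[X G_*(X)], the constant G_*(0)
being killed by E[X] = 0. The same formula for Z has value 0. If the three terms agree for X and Z,
then γ = g_* almost surely under X, so g_* is a Stein kernel of X as well.

The kernel g_* determines the law (`IsTargetLaw.eq_of_kernel`). On (l, u) the law of X has density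
(φ/ψ) ρ, with φ and ψ the tails E[X 1_{X ≥ y}] and E[Z 1_{Z ≥ y}]. Differentiating the tails gives
(φ/ψ)' = 0, so the two laws are proportional on (l, u). A comparison of second moments excludes mass
elsewhere. The alternative between a bounded g_* and a density for X ensures that X does not charge
the zeros of ρ, where g_* carries no information. -/

open scoped ENNReal

/-! ### The tail moment function and Fubini's theorem -/

/-- The function `y ↦ E[X 1_{X ≥ y}]` of a centered law `μ` of `X`, written with a nonnegative
integrand. -/
noncomputable def steinMass (μ : Measure ℝ) (y : ℝ) : ℝ≥0∞ :=
  ∫⁻ x, ‖x‖ₑ * (Set.uIoc 0 x).indicator 1 y ∂μ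

lemma mem_uIoc_zero_iff {x y : ℝ} : y ∈ Set.uIoc 0 x ↔ (0 < y ∧ y ≤ x) ∨ (x < y ∧ y ≤ 0) := by
  rw [Set.mem_uIoc]

lemma measurableSet_uIoc_zero : MeasurableSet {p : ℝ × ℝ | p.2 ∈ Set.uIoc 0 p.1} := by
  simp only [mem_uIoc_zero_iff]
  measurability

lemma measurable_uIoc_indicator :
    Measurable fun p : ℝ × ℝ => (Set.uIoc 0 p.1).indicator (1 : ℝ → ℝ≥0∞) p.2 := by
  have : (fun p : ℝ × ℝ => (Set.uIoc 0 p.1).indicator (1 : ℝ → ℝ≥0∞) p.2) =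
      {p : ℝ × ℝ | p.2 ∈ Set.uIoc 0 p.1}.indicator 1 := by
    ext p
    by_cases h : p.2 ∈ Set.uIoc 0 p.1 <;> simp [h]
  rw [this]
  exact measurable_one.indicator measurableSet_uIoc_zero

lemma measurable_steinMass (μ : Measure ℝ) [SFinite μ] : Measurable (steinMass μ) := by
  refine Measurable.lintegral_prod_right'
    (f := fun p : ℝ × ℝ => ‖p.2‖ₑ * (Set.uIoc 0 p.2).indicator (1 : ℝ → ℝ≥0∞) p.1) ?_
  exact measurable_snd.enorm.mul (measurable_uIoc_indicator.comp measurable_swap)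

/-- Tonelli. With the nonnegative integrand |x| 1_{y between 0 and x} no integrability of g against
m has to be known in advance. -/
lemma lintegral_mul_steinMass (μ : Measure ℝ) [SFinite μ] {g : ℝ → ℝ≥0∞} (hg : Measurable g) :
    ∫⁻ y, g y * steinMass μ y = ∫⁻ x, ‖x‖ₑ * (∫⁻ y in Set.uIoc 0 x, g y) ∂μ := by
  have h1 : ∀ y, g y * steinMass μ y =
      ∫⁻ x, ‖x‖ₑ * (Set.uIoc 0 x).indicator g y ∂μ := by
    intro y
    rw [steinMass, ← lintegral_const_mul]
    · refine lintegral_congr fun x => ?_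
      by_cases h : y ∈ Set.uIoc 0 x <;> simp [h, mul_comm]
    · exact measurable_enorm.mul
        (measurable_uIoc_indicator.comp (measurable_id.prodMk measurable_const))
  simp_rw [h1]
  rw [lintegral_lintegral_swap]
  · refine lintegral_congr fun x => ?_
    rw [lintegral_const_mul _ (hg.indicator measurableSet_uIoc),
      lintegral_indicator measurableSet_uIoc]
  · have : (Function.uncurry fun y x => ‖x‖ₑ * (Set.uIoc 0 x).indicator g y) =
        fun p : ℝ × ℝ => ‖p.2‖ₑ * ((Set.uIoc 0 p.2).indicator (1 : ℝ → ℝ≥0∞) p.1 * g p.1) := by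
      ext p
      by_cases h : p.1 ∈ Set.uIoc 0 p.2 <;> simp [Function.uncurry, h]
    rw [this]
    exact (measurable_snd.enorm.mul ((measurable_uIoc_indicator.comp measurable_swap).mul
      (hg.comp measurable_fst))).aemeasurable

/-- The interval between 0 and x has length |x|. So m dy is a finite measure exactly when `μ` has a
second moment, which is also what controls mass outside (l, u) later. -/
lemma lintegral_steinMass (μ : Measure ℝ) [SFinite μ] :
    ∫⁻ y, steinMass μ y = ∫⁻ x, ‖x‖ₑ ^ 2 ∂μ := by
  have := lintegral_mul_steinMass μ (g := 1) measurable_one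
  simp only [Pi.one_apply, one_mul, lintegral_const, MeasurableSet.univ,
    Measure.restrict_apply, Set.univ_inter] at this
  rw [this]
  refine lintegral_congr fun x => ?_
  rw [sq, Set.uIoc, Real.volume_Ioc, max_sub_min_eq_abs, sub_zero, Real.enorm_eq_ofReal_abs]

/-- For y ≤ 0 centering turns E[X 1_{X ≥ y}] into E[-X 1_{X < y}], whose integrand is nonnegative.
-/
lemma steinMass_eq_ofReal {μ : Measure ℝ} (hi : Integrable id μ) (h0 : ∫ x, x ∂μ = 0) (y : ℝ) :
    steinMass μ y = ENNReal.ofReal (∫ x in Set.Ici y, x ∂μ) := by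
  have hi' : Integrable (fun x : ℝ => x) μ := hi
  rcases lt_or_ge 0 y with hy | hy
  · rw [ofReal_integral_eq_lintegral_ofReal hi'.integrableOn, steinMass,
      ← lintegral_indicator measurableSet_Ici]
    · refine lintegral_congr fun x => ?_
      by_cases hx : y ≤ x
      · have : y ∈ Set.uIoc 0 x := mem_uIoc_zero_iff.2 (Or.inl ⟨hy, hx⟩)
        simp [this, hx, Real.enorm_eq_ofReal (hy.le.trans hx)]
      · have : y ∉ Set.uIoc 0 x := fun h => by
          rcases mem_uIoc_zero_iff.1 h with h | h <;> linarith [h.1, h.2]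
        simp [this, hx]
    · filter_upwards [ae_restrict_mem measurableSet_Ici] with x hx
      exact hy.le.trans hx
  · have h1 : ∫ x in Set.Ici y, x ∂μ = ∫ x in Set.Iio y, -x ∂μ := by
      have := integral_add_compl (measurableSet_Ici (a := y)) hi'
      rw [h0, Set.compl_Ici] at this
      rw [integral_neg]; linarith
    rw [h1, ofReal_integral_eq_lintegral_ofReal
        (show Integrable (fun x => -x) μ from hi'.neg).integrableOn, steinMass,
      ← lintegral_indicator measurableSet_Iio]
    · refine lintegral_congr fun x => ?_
      by_cases hx : x < y
      · have : y ∈ Set.uIoc 0 x := mem_uIoc_zero_iff.2 (Or.inr ⟨hx, hy⟩)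
        simp [this, hx, Real.enorm_eq_ofReal_abs, abs_of_neg (hx.trans_le hy)]
      · have : y ∉ Set.uIoc 0 x := fun h => by
          rcases mem_uIoc_zero_iff.1 h with h | h <;> linarith [h.1, h.2]
        simp [this, hx]
    · filter_upwards [ae_restrict_mem measurableSet_Iio] with x hx
      have : x < y := hx
      simp only [Pi.zero_apply]
      linarith

lemma integral_Ici_nonneg {μ : Measure ℝ} (hi : Integrable id μ) (h0 : ∫ x, x ∂μ = 0) (y : ℝ) :
    0 ≤ ∫ x in Set.Ici y, x ∂μ := by
  have hi' : Integrable (fun x : ℝ => x) μ := hi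
  rcases le_or_gt 0 y with hy | hy
  · exact setIntegral_nonneg measurableSet_Ici fun x hx => hy.trans hx
  · have := integral_add_compl (measurableSet_Ici (a := y)) hi'
    rw [h0, Set.compl_Ici] at this
    have h2 : ∫ x in Set.Iio y, x ∂μ ≤ 0 :=
      setIntegral_nonpos measurableSet_Iio fun x hx => (lt_trans hx hy).le
    linarith

/-- The integral against `steinMass` of the derivative of `G`. -/
lemma lintegral_mul_steinMass_antideriv (μ : Measure ℝ) [SFinite μ] {g G : ℝ → ℝ}
    (hgm : Measurable g) (hg : ∀ x, 0 ≤ g x) (hG : IsAntideriv G g) :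
    ∫⁻ y, ENNReal.ofReal (g y) * steinMass μ y = ∫⁻ x, ENNReal.ofReal (x * (G x - G 0)) ∂μ ∧
      ∀ x, 0 ≤ x * (G x - G 0) := by
  have key : ∀ x, 0 ≤ x * (G x - G 0) ∧
      ‖x‖ₑ * ∫⁻ y in Set.uIoc 0 x, ENNReal.ofReal (g y) = ENNReal.ofReal (x * (G x - G 0)) := by
    intro x
    obtain ⟨hint, heq⟩ := hG 0 x
    have h1 : ∫⁻ y in Set.uIoc 0 x, ENNReal.ofReal (g y) =
        ENNReal.ofReal (∫ y in Set.uIoc 0 x, g y) := by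
      rw [ofReal_integral_eq_lintegral_ofReal]
      · exact hint.def'
      · exact ae_of_all _ hg
    have h2 : x * (G x - G 0) = |x| * ∫ y in Set.uIoc 0 x, g y := by
      rw [← heq]
      rcases le_total 0 x with hx | hx
      · rw [intervalIntegral.integral_of_le hx, Set.uIoc_of_le hx, abs_of_nonneg hx]
      · rw [intervalIntegral.integral_of_ge hx, Set.uIoc_of_ge hx, abs_of_nonpos hx]; ring
    rw [h2, h1, ENNReal.ofReal_mul (abs_nonneg x), Real.enorm_eq_ofReal_abs]
    exact ⟨mul_nonneg (abs_nonneg x) (setIntegral_nonneg measurableSet_uIoc fun y _ => hg y), rfl⟩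
  refine ⟨?_, fun x => (key x).1⟩
  rw [lintegral_mul_steinMass μ hgm.ennreal_ofReal]
  exact lintegral_congr fun x => (key x).2

lemma isOpen_realIoo (l u : EReal) : IsOpen (realIoo l u) :=
  isOpen_Ioo.preimage continuous_coe_real_ereal

lemma measurableSet_realIoo (l u : EReal) : MeasurableSet (realIoo l u) :=
  (isOpen_realIoo l u).measurableSet

lemma ordConnected_realIoo (l u : EReal) : (realIoo l u).OrdConnected :=
  ⟨fun _ hx _ hy _ hz => ⟨hx.1.trans_le (EReal.coe_le_coe_iff.2 hz.1),
    (EReal.coe_le_coe_iff.2 hz.2).trans_lt hy.2⟩⟩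

/-! ### The target law: positive tails and its Stein kernel -/

section Target

variable {ν : Measure ℝ} {l u : EReal} {ρ : ℝ → ℝ}

lemma IsTargetLaw.zero_mem (h : IsTargetLaw ν l u ρ) : (0 : ℝ) ∈ realIoo l u :=
  ⟨by simpa using h.left_neg, by simpa using h.right_pos⟩

lemma IsTargetLaw.absolutelyContinuous (h : IsTargetLaw ν l u ρ) : ν ≪ volume := by
  rw [h.law_eq]; exact withDensity_absolutelyContinuous _ _

/-- The support condition only gives the closed interval; the endpoints are negligible because the
frontier of a convex set is Lebesgue-null. -/
lemma IsTargetLaw.measure_compl (h : IsTargetLaw ν l u ρ) : ν (realIoo l u)ᶜ = 0 := by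
  have h1 : ν (closure (realIoo l u))ᶜ = 0 := by
    rw [← h.support_eq]; exact Measure.measure_compl_support
  have h2 : ν (frontier (realIoo l u)) = 0 :=
    h.absolutelyContinuous ((ordConnected_realIoo l u).convex.addHaar_frontier volume)
  refine measure_mono_null ?_ (measure_union_null h1 h2)
  intro x hx
  by_cases hc : x ∈ closure (realIoo l u)
  · right
    rw [(isOpen_realIoo l u).frontier_eq]
    exact ⟨hc, hx⟩
  · exact Or.inl hc

lemma IsTargetLaw.measure_pos (h : IsTargetLaw ν l u ρ) {s : Set ℝ} (hs : IsOpen s) {x : ℝ}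
    (hx : x ∈ s) (hxl : x ∈ realIoo l u) : 0 < ν s := by
  have : x ∈ ν.support := by rw [h.support_eq]; exact subset_closure hxl
  exact (Measure.mem_support_iff_forall x).1 this s (hs.mem_nhds hx)

/-- The integrand has a constant sign on the side of `z` away from 0, and a point of the support
lies strictly beyond `z` on that side. -/
lemma IsTargetLaw.tail_pos (h : IsTargetLaw ν l u ρ) (hi : Integrable id ν)
    (h0 : ∫ x, x ∂ν = 0) {z : ℝ} (hz : z ∈ realIoo l u) : 0 < ∫ x in Set.Ici z, x ∂ν := by
  have hi' : Integrable (fun x : ℝ => x) ν := hi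
  rcases le_or_gt 0 z with hz0 | hz0
  · rw [setIntegral_pos_iff_support_of_nonneg_ae _ hi'.integrableOn]
    · obtain ⟨y, hy, hzy⟩ := ((nhdsWithin_Ioi_neBot le_rfl).nonempty_of_mem (inter_mem
        (mem_nhdsWithin_of_mem_nhds ((isOpen_realIoo l u).mem_nhds hz)) self_mem_nhdsWithin) :
        (realIoo l u ∩ Set.Ioi z).Nonempty)
      refine (h.measure_pos isOpen_Ioi hzy hy).trans_le (measure_mono fun x hx => ?_)
      have hx' : z < x := hx
      exact ⟨(hz0.trans_lt hx').ne', hx'.le⟩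
    · filter_upwards [ae_restrict_mem measurableSet_Ici] with x hx
      exact hz0.trans hx
  · have h1 : ∫ x in Set.Ici z, x ∂ν = ∫ x in Set.Iio z, -x ∂ν := by
      have := integral_add_compl (measurableSet_Ici (a := z)) hi'
      rw [h0, Set.compl_Ici] at this
      rw [integral_neg]; linarith
    rw [h1, setIntegral_pos_iff_support_of_nonneg_ae _
      (show Integrable (fun x => -x) ν from hi'.neg).integrableOn]
    · obtain ⟨y, hy, hzy⟩ := ((nhdsWithin_Iio_neBot le_rfl).nonempty_of_mem (inter_mem
        (mem_nhdsWithin_of_mem_nhds ((isOpen_realIoo l u).mem_nhds hz)) self_mem_nhdsWithin) :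
        (realIoo l u ∩ Set.Iio z).Nonempty)
      refine (h.measure_pos isOpen_Iio hzy hy).trans_le (measure_mono fun x hx => ?_)
      have hx' : x < z := hx
      exact ⟨by simpa using (hx'.trans hz0).ne, hx'⟩
    · filter_upwards [ae_restrict_mem measurableSet_Iio] with x hx
      have hx' : x < z := hx
      simp only [Pi.zero_apply]
      linarith

lemma IsTargetLaw.setIntegral_eq (h : IsTargetLaw ν l u ρ) (f : ℝ → ℝ) {s : Set ℝ}
    (hs : MeasurableSet s) : ∫ x in s, f x ∂ν = ∫ x in s, f x * ρ x := by
  rw [h.law_eq, restrict_withDensity hs, integral_withDensity_eq_integral_toReal_smul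
    h.measurable_density.ennreal_ofReal (ae_of_all _ fun x => ENNReal.ofReal_lt_top)]
  refine integral_congr_ae (ae_of_all _ fun x => ?_)
  simp [ENNReal.toReal_ofReal (h.density_nonneg x), mul_comm]

/-- The law lives on (l, u) and has no atom at `z`, so ∫_z^u y ρ(y) dy is the tail over [z, ∞). -/
lemma IsTargetLaw.gStar_eq (h : IsTargetLaw ν l u ρ) {z : ℝ} (hz : z ∈ realIoo l u) :
    gStar ρ l u z = (∫ x in Set.Ici z, x ∂ν) / ρ z := by
  rw [gStar, Set.indicator_of_mem hz, ← h.setIntegral_eq _ (measurableSet_realIoo _ _)]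
  congr 1
  refine setIntegral_congr_set ?_
  have h1 : ∀ᵐ x ∂ν, x ∈ realIoo l u := h.measure_compl
  have h2 : ∀ᵐ x ∂ν, x ≠ z := by
    have : ν {z} = 0 := h.absolutelyContinuous (by simp)
    exact measure_eq_zero_iff_ae_notMem.1 this
  filter_upwards [h1, h2] with x hx hxz
  refine propext ⟨fun hxm => ?_, fun hxm => ⟨?_, hx.2⟩⟩
  · exact (EReal.coe_lt_coe_iff.1 hxm.1).le
  · exact EReal.coe_lt_coe_iff.2 (lt_of_le_of_ne hxm hxz.symm)

lemma IsTargetLaw.gStar_nonneg (h : IsTargetLaw ν l u ρ) (hi : Integrable id ν)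
    (h0 : ∫ x, x ∂ν = 0) (z : ℝ) : 0 ≤ gStar ρ l u z := by
  by_cases hz : z ∈ realIoo l u
  · rw [h.gStar_eq hz]
    exact div_nonneg (integral_Ici_nonneg hi h0 z) (h.density_nonneg z)
  · rw [gStar, Set.indicator_of_notMem hz]

lemma IsTargetLaw.measurable_gStar [SFinite ν] (h : IsTargetLaw ν l u ρ) (hi : Integrable id ν)
    (h0 : ∫ x, x ∂ν = 0) : Measurable (gStar ρ l u) := by
  have : gStar ρ l u = (realIoo l u).indicator fun z => (steinMass ν z).toReal / ρ z := by
    ext z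
    by_cases hz : z ∈ realIoo l u
    · rw [h.gStar_eq hz, Set.indicator_of_mem hz, steinMass_eq_ofReal hi h0,
        ENNReal.toReal_ofReal (integral_Ici_nonneg hi h0 z)]
    · rw [gStar, Set.indicator_of_notMem hz, Set.indicator_of_notMem hz]
  rw [this]
  exact ((measurable_steinMass ν).ennreal_toReal.div h.measurable_density).indicator
    (measurableSet_realIoo l u)

/-- A nonnegative Stein kernel of a centered law `μ`: `E[γ(X) 1_B(X)] = ∫_B E[X 1_{X ≥ y}] dy`. -/
structure IsSteinKernel (μ : Measure ℝ) (γ : ℝ → ℝ) : Prop where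
  measurable : Measurable γ
  nonneg : ∀ x, 0 ≤ γ x
  withDensity_eq : μ.withDensity (fun x => ENNReal.ofReal (γ x)) = volume.withDensity (steinMass μ)

lemma IsTargetLaw.steinMass_pos (h : IsTargetLaw ν l u ρ) (hi : Integrable id ν)
    (h0 : ∫ x, x ∂ν = 0) {z : ℝ} (hz : z ∈ realIoo l u) : 0 < steinMass ν z := by
  rw [steinMass_eq_ofReal hi h0]
  exact ENNReal.ofReal_pos.2 (h.tail_pos hi h0 hz)

/-- Both sides are Lebesgue densities of the same measure γ·ν = m dy. -/
lemma IsSteinKernel.volume_mul_density [SFinite ν] {γ : ℝ → ℝ} (h : IsTargetLaw ν l u ρ)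
    (hγ : IsSteinKernel ν γ) :
    (fun x => ENNReal.ofReal (ρ x) * ENNReal.ofReal (γ x)) =ᵐ[volume] steinMass ν := by
  have h1 := hγ.withDensity_eq
  nth_rewrite 1 [h.law_eq] at h1
  rw [← withDensity_mul _ h.measurable_density.ennreal_ofReal hγ.measurable.ennreal_ofReal] at h1
  exact (withDensity_eq_iff_of_sigmaFinite
    (h.measurable_density.ennreal_ofReal.mul hγ.measurable.ennreal_ofReal).aemeasurable
    (measurable_steinMass ν).aemeasurable).1 h1

/-- Since ρ γ = m almost everywhere and m > 0 on (l, u), ρ vanishes there only on a null set. The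
mere existence of a kernel forces this. -/
lemma IsTargetLaw.density_pos [SFinite ν] {γ : ℝ → ℝ} (h : IsTargetLaw ν l u ρ)
    (hi : Integrable id ν) (h0 : ∫ x, x ∂ν = 0) (hγ : IsSteinKernel ν γ) :
    ∀ᵐ x, x ∈ realIoo l u → 0 < ρ x := by
  filter_upwards [hγ.volume_mul_density h] with x hx hxl
  refine lt_of_le_of_ne (h.density_nonneg x) fun h2 => ?_
  rw [← h2, ENNReal.ofReal_zero, zero_mul] at hx
  exact (h.steinMass_pos hi h0 hxl).ne hx

/-- On the target law the Stein kernel is `gStar`. -/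
lemma IsTargetLaw.kernel_eq [SFinite ν] {γ : ℝ → ℝ} (h : IsTargetLaw ν l u ρ)
    (hi : Integrable id ν) (h0 : ∫ x, x ∂ν = 0) (hγ : IsSteinKernel ν γ) :
    γ =ᵐ[ν] gStar ρ l u := by
  have h1 : ∀ᵐ x ∂ν, x ∈ realIoo l u := h.measure_compl
  filter_upwards [h1, h.absolutelyContinuous.ae_le (h.density_pos hi h0 hγ),
    h.absolutelyContinuous.ae_le (hγ.volume_mul_density h)] with x hx hρ heq
  have hp := hρ hx
  rw [h.gStar_eq hx, eq_div_iff hp.ne']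
  rw [steinMass_eq_ofReal hi h0, ← ENNReal.ofReal_mul hp.le,
    ENNReal.ofReal_eq_ofReal_iff (mul_nonneg hp.le (hγ.nonneg x))
      (integral_Ici_nonneg hi h0 x)] at heq
  linarith

end Target

/-! ### Regularity of the tail moment on an interval where the law has a density -/

section Tail

variable {μ : Measure ℝ} {S : Set ℝ} {r : ℝ → ℝ}

/-- Only the part of `μ` on `S` needs a density, since the contribution beyond the larger of `a` and
`b` cancels. This matters for the law of X, which may a priori charge the complement of (l, u). -/
lemma tail_eq_sub_integral (hi : Integrable id μ) (hS : S.OrdConnected)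
    (hr : Measurable r) (hr0 : ∀ x, 0 ≤ r x)
    (hμ : μ.restrict S = (volume.restrict S).withDensity fun x => ENNReal.ofReal (r x))
    {a b : ℝ} (ha : a ∈ S) (hb : b ∈ S) :
    IntervalIntegrable (fun x => x * r x) volume a b ∧
      ∫ x in Set.Ici b, x ∂μ = (∫ x in Set.Ici a, x ∂μ) - ∫ x in a..b, x * r x := by
  have hi' : Integrable (fun x : ℝ => x) μ := hi
  have hmul : ∀ x, (ENNReal.ofReal (r x)).toReal • x = x * r x := fun x => by
    rw [ENNReal.toReal_ofReal (hr0 x), smul_eq_mul, mul_comm]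
  have key : ∀ {c d : ℝ}, c ∈ S → d ∈ S → c ≤ d → IntegrableOn (fun x => x * r x) (Set.Ico c d) ∧
      ∫ x in Set.Ici d, x ∂μ = (∫ x in Set.Ici c, x ∂μ) - ∫ x in Set.Ico c d, x * r x := by
    intro c d hc hd hcd
    have hsub : Set.Ico c d ⊆ S := Set.Ico_subset_Icc_self.trans (hS.out hc hd)
    have hres : μ.restrict (Set.Ico c d) =
        (volume.restrict (Set.Ico c d)).withDensity fun x => ENNReal.ofReal (r x) := by
      have := congrArg (fun m => Measure.restrict m (Set.Ico c d)) hμ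
      simpa only [restrict_withDensity measurableSet_Ico,
        Measure.restrict_restrict measurableSet_Ico,
          Set.inter_eq_self_of_subset_left hsub] using this
    have h1 : ∫ x in Set.Ici c, x ∂μ = (∫ x in Set.Ico c d, x ∂μ) + ∫ x in Set.Ici d, x ∂μ := by
      rw [← setIntegral_union _ measurableSet_Ici hi'.integrableOn hi'.integrableOn,
        Set.Ico_union_Ici_eq_Ici hcd]
      exact Set.disjoint_left.2 fun x hx hx' => not_lt.2 hx' hx.2
    have h2 : ∫ x in Set.Ico c d, x ∂μ = ∫ x in Set.Ico c d, x * r x := by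
      rw [hres, integral_withDensity_eq_integral_toReal_smul hr.ennreal_ofReal
        (ae_of_all _ fun x => ENNReal.ofReal_lt_top)]
      simp_rw [hmul]
    refine ⟨?_, by rw [h1, h2]; ring⟩
    have h3 : Integrable (fun x : ℝ => x) (μ.restrict (Set.Ico c d)) := hi'.integrableOn
    rw [hres, integrable_withDensity_iff_integrable_smul' hr.ennreal_ofReal
        (ae_of_all _ fun x => ENNReal.ofReal_lt_top)] at h3
    simp_rw [hmul] at h3
    exact h3
  rcases le_total a b with hab | hab
  · obtain ⟨h1, h2⟩ := key ha hb hab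
    rw [intervalIntegrable_iff_integrableOn_Ico_of_le hab, intervalIntegral.integral_of_le hab,
      ← integral_Ico_eq_integral_Ioc]
    exact ⟨h1, h2⟩
  · obtain ⟨h1, h2⟩ := key hb ha hab
    rw [intervalIntegral.integral_of_ge hab, ← integral_Ico_eq_integral_Ioc]
    exact ⟨((intervalIntegrable_iff_integrableOn_Ico_of_le hab).2 h1).symm, by linarith⟩

lemma continuousOn_tail (hi : Integrable id μ) (hS : S.OrdConnected) (hSo : IsOpen S)
    (hr : Measurable r) (hr0 : ∀ x, 0 ≤ r x)
    (hμ : μ.restrict S = (volume.restrict S).withDensity fun x => ENNReal.ofReal (r x)) :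
    ContinuousOn (fun y => ∫ x in Set.Ici y, x ∂μ) S := by
  intro z hz
  obtain ⟨a, b, hzab, hab⟩ : ∃ a b, z ∈ Set.Ioo a b ∧ Set.Icc a b ⊆ S := by
    obtain ⟨ε, hε, hb⟩ := Metric.isOpen_iff.1 hSo z hz
    refine ⟨z - ε / 2, z + ε / 2, ⟨by linarith, by linarith⟩, fun x hx => hb ?_⟩
    rw [Metric.mem_ball, Real.dist_eq, abs_lt]
    constructor <;> linarith [hx.1, hx.2]
  have hlt : a < b := hzab.1.trans hzab.2
  have haS := hab (Set.left_mem_Icc.2 hlt.le)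
  have hbS := hab (Set.right_mem_Icc.2 hlt.le)
  have h1 := (tail_eq_sub_integral hi hS hr hr0 hμ haS hbS).1
  have h2 : ContinuousOn (fun y => ∫ x in a..y, x * r x) (Set.uIcc a b) :=
    intervalIntegral.continuousOn_primitive_interval
      (by rw [Set.uIcc_of_le hlt.le, integrableOn_Icc_iff_integrableOn_Ioc]
          exact (intervalIntegrable_iff_integrableOn_Ioc_of_le hlt.le).1 h1)
  have h3 : ContinuousAt (fun y => ∫ x in a..y, x * r x) z :=
    h2.continuousAt (by rw [Set.uIcc_of_le hlt.le]; exact Icc_mem_nhds hzab.1 hzab.2)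
  refine ContinuousAt.continuousWithinAt ?_
  refine (continuousAt_const.sub h3).congr (f := fun y => (∫ x in Set.Ici a, x ∂μ) -
    ∫ x in a..y, x * r x) ?_
  filter_upwards [hSo.mem_nhds hz] with y hy
  exact (tail_eq_sub_integral hi hS hr hr0 hμ haS hy).2.symm

lemma hasDerivAt_tail (hi : Integrable id μ) (hS : S.OrdConnected) (hSo : IsOpen S)
    (hr : Measurable r) (hr0 : ∀ x, 0 ≤ r x)
    (hμ : μ.restrict S = (volume.restrict S).withDensity fun x => ENNReal.ofReal (r x))
    {z : ℝ} (hz : z ∈ S) (hc : ContinuousAt r z) :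
    HasDerivAt (fun y => ∫ x in Set.Ici y, x ∂μ) (-(z * r z)) z := by
  have hcz : ContinuousAt (fun x => x * r x) z := continuousAt_id.mul hc
  have h1 : HasDerivAt (fun y => ∫ x in z..y, x * r x) (z * r z) z :=
    intervalIntegral.integral_hasDerivAt_right
      (tail_eq_sub_integral hi hS hr hr0 hμ hz hz).1
      ((measurable_id.mul hr).stronglyMeasurable.stronglyMeasurableAtFilter) hcz
  refine (h1.const_sub (∫ x in Set.Ici z, x ∂μ)).congr_of_eventuallyEq ?_
  filter_upwards [hSo.mem_nhds hz] with y hy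
  exact (tail_eq_sub_integral hi hS hr hr0 hμ hz hy).2

end Tail

/-! ### A law with kernel g_* is the target law -/

section Identification

variable {μ ν : Measure ℝ} {l u : EReal} {ρ : ℝ → ℝ}

lemma IsTargetLaw.restrict_eq (h : IsTargetLaw ν l u ρ) :
    ν.restrict (realIoo l u) =
      (volume.restrict (realIoo l u)).withDensity fun x => ENNReal.ofReal (ρ x) := by
  nth_rewrite 1 [h.law_eq]
  exact restrict_withDensity (measurableSet_realIoo l u) _

/-- If `gStar` is bounded then the density does not vanish on `(l, u)`. -/
lemma IsTargetLaw.density_pos_of_bounded [IsFiniteMeasure ν] {γ : ℝ → ℝ}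
    (h : IsTargetLaw ν l u ρ) (hi : Integrable id ν) (h0 : ∫ x, x ∂ν = 0)
    (hγ : IsSteinKernel ν γ) {M : ℝ} (hM : ∀ x, |gStar ρ l u x| ≤ M) {z : ℝ}
    (hz : z ∈ realIoo l u) : 0 < ρ z := by
  have hS := (isOpen_realIoo l u).mem_nhds hz
  by_contra hneg
  have hz0 : ρ z = 0 := le_antisymm (not_lt.1 hneg) (h.density_nonneg z)
  -- If ρ(z) = 0, then near `z` the product M ρ is small while the tail stays near a positive value.
  -- Points with ρ > 0 are dense in (l, u), and there g_* ≤ M says that the tail is at most M ρ.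
  have hcont : Tendsto (fun y => M * ρ y) (𝓝 z) (𝓝 0) := by
    have := ((h.continuousOn_density.continuousAt hS).tendsto).const_mul M
    rwa [hz0, mul_zero] at this
  have htail : Tendsto (fun y => ∫ x in Set.Ici y, x ∂ν) (𝓝 z) (𝓝 (∫ x in Set.Ici z, x ∂ν)) :=
    (continuousOn_tail hi (ordConnected_realIoo l u) (isOpen_realIoo l u) h.measurable_density
      h.density_nonneg h.restrict_eq).continuousAt hS
  have hev : ∀ᶠ y in 𝓝 z, M * ρ y < ∫ x in Set.Ici y, x ∂ν :=
    hcont.eventually_lt htail (h.tail_pos hi h0 hz)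
  obtain ⟨y, hyρ, hy, hyS⟩ :=
    (Measure.dense_of_ae (h.density_pos hi h0 hγ)).inter_nhds_nonempty (inter_mem hev hS)
  have hp := hyρ hyS
  have := (le_abs_self _).trans (hM y)
  rw [h.gStar_eq hyS, div_le_iff₀ hp] at this
  exact not_lt.2 this hy

/-- A centered law with the same Stein kernel as the target law is the target law. -/
theorem IsTargetLaw.eq_of_kernel [IsProbabilityMeasure μ] [IsProbabilityMeasure ν] {γ : ℝ → ℝ}
    (h : IsTargetLaw ν l u ρ) (hi : Integrable id ν) (h0 : ∫ x, x ∂ν = 0)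
    (hγ : IsSteinKernel ν γ)
    (hiμ : Integrable id μ) (h0μ : ∫ x, x ∂μ = 0) (h2μ : Integrable (fun x => x ^ 2) μ)
    (hk : IsSteinKernel μ (gStar ρ l u)) (hN : μ {x | x ∈ realIoo l u ∧ ρ x = 0} = 0) :
    μ = ν := by
  set S := realIoo l u with hSdef
  have hSo : IsOpen S := isOpen_realIoo l u
  have hSm := hSo.measurableSet
  set φ : ℝ → ℝ := fun y => ∫ x in Set.Ici y, x ∂μ with hφ
  set ψ : ℝ → ℝ := fun y => ∫ x in Set.Ici y, x ∂ν with hψ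
  have hφm : Measurable φ := by
    have : φ = fun y => (steinMass μ y).toReal := by
      ext y; rw [steinMass_eq_ofReal hiμ h0μ, ENNReal.toReal_ofReal (integral_Ici_nonneg hiμ h0μ y)]
    rw [this]; exact (measurable_steinMass μ).ennreal_toReal
  have hψm : Measurable ψ := by
    have : ψ = fun y => (steinMass ν y).toReal := by
      ext y; rw [steinMass_eq_ofReal hi h0, ENNReal.toReal_ofReal (integral_Ici_nonneg hi h0 y)]
    rw [this]; exact (measurable_steinMass ν).ennreal_toReal
  have hψpos : ∀ {z}, z ∈ S → 0 < ψ z := fun hz => h.tail_pos hi h0 hz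
  -- This is φ / g_* with g_* = ψ / ρ: the density of `μ` on `S` obtained by dividing g_*·μ = φ dy
  -- by g_*.
  set r : ℝ → ℝ := fun x => φ x / ψ x * ρ x with hr
  have hrm : Measurable r := (hφm.div hψm).mul h.measurable_density
  have hr0 : ∀ x, 0 ≤ r x := fun x => mul_nonneg (div_nonneg (integral_Ici_nonneg hiμ h0μ x)
    (integral_Ici_nonneg hi h0 x)) (h.density_nonneg x)
  have hres : μ.restrict S = (volume.restrict S).withDensity fun x => ENNReal.ofReal (r x) := by
    have h3 := congrArg (fun m => Measure.restrict m S) hk.withDensity_eq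
    simp only [restrict_withDensity hSm] at h3
    have hgm := hk.measurable.ennreal_ofReal
    -- At a zero of ρ the quotient defining g_* is 0 by convention, and g_*·μ does not see `μ`
    -- there; `hN` excludes such points.
    have hgne : ∀ᵐ x ∂(μ.restrict S), ENNReal.ofReal (gStar ρ l u x) ≠ 0 := by
      rw [ae_restrict_iff' hSm]
      filter_upwards [measure_eq_zero_iff_ae_notMem.1 hN] with x hx hxS
      have hp : 0 < ρ x := lt_of_le_of_ne (h.density_nonneg x) fun h4 => hx ⟨hxS, h4.symm⟩
      rw [h.gStar_eq hxS]
      exact (ENNReal.ofReal_pos.2 (div_pos (hψpos hxS) hp)).ne'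
    rw [← withDensity_inv_same hgm hgne (ae_of_all _ fun x => ENNReal.ofReal_ne_top), h3,
      ← withDensity_mul (volume.restrict S) (g := fun x => (ENNReal.ofReal (gStar ρ l u x))⁻¹)
        (measurable_steinMass μ) hgm.inv]
    refine withDensity_congr_ae ?_
    rw [EventuallyEq, ae_restrict_iff' hSm]
    filter_upwards [h.density_pos hi h0 hγ] with x hx hxS
    have hp := hx hxS
    rw [Pi.mul_apply, h.gStar_eq hxS, steinMass_eq_ofReal hiμ h0μ,
      ← ENNReal.ofReal_inv_of_pos (div_pos (hψpos hxS) hp), ← ENNReal.ofReal_mul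
      (integral_Ici_nonneg hiμ h0μ x)]
    congr 1
    simp only [hr, hφ, hψ]
    rw [inv_div]; ring
  have hSord := ordConnected_realIoo l u
  have hφc := continuousOn_tail hiμ hSord hSo hrm hr0 hres
  have hψc := continuousOn_tail hi hSord hSo h.measurable_density h.density_nonneg h.restrict_eq
  have hρc := h.continuousOn_density
  -- Continuity of the tails makes `r` continuous, hence the tails are differentiable: φ' = -z φ ρ /
  -- ψ and ψ' = -z ρ, so φ'ψ = φψ'.
  have hderiv : ∀ z ∈ S, HasDerivAt (fun x => φ x / ψ x) 0 z := by
    intro z hz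
    have hn := hSo.mem_nhds hz
    have hne := (hψpos hz).ne'
    have d1 := hasDerivAt_tail hiμ hSord hSo hrm hr0 hres hz
      (((hφc.continuousAt hn).div (hψc.continuousAt hn) hne).mul (hρc.continuousAt hn))
    have d2 := hasDerivAt_tail hi hSord hSo h.measurable_density h.density_nonneg h.restrict_eq hz
      (hρc.continuousAt hn)
    refine (d1.div d2 hne).congr_deriv ?_
    simp only [hr]
    field_simp
    ring
  obtain ⟨c, hc⟩ : ∃ c, ∀ z ∈ S, φ z / ψ z = c :=
    hSo.exists_is_const_of_deriv_eq_zero hSord.isPreconnected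
      (fun z hz => (hderiv z hz).differentiableAt.differentiableWithinAt)
      (fun z hz => (hderiv z hz).deriv)
  have hc0 : 0 ≤ c := by
    rw [← hc 0 h.zero_mem]
    exact div_nonneg (integral_Ici_nonneg hiμ h0μ 0) (integral_Ici_nonneg hi h0 0)
  have hνS : ν.restrict S = ν := Measure.restrict_eq_self_of_ae_mem h.measure_compl
  have hμS : μ.restrict S = ENNReal.ofReal c • ν := by
    rw [hres, ← hνS, h.restrict_eq, ← withDensity_smul _ h.measurable_density.ennreal_ofReal]
    refine withDensity_congr_ae ?_
    rw [EventuallyEq, ae_restrict_iff' hSm]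
    refine ae_of_all _ fun x hx => ?_
    simp only [hr, hc x hx, Pi.smul_apply, smul_eq_mul, ENNReal.ofReal_mul hc0]
  -- The second moment of `μ` is the integral of its tail function. This vanishes almost everywhere
  -- off `S`, where g_* = 0, and is c times that of `ν` on `S`; so it is at most c E[Z²], the second
  -- moment of the part of `μ` on `S`.
  have hsq : ∫⁻ x, ‖x‖ₑ ^ 2 ∂μ ≤ ∫⁻ x in S, ‖x‖ₑ ^ 2 ∂μ := by
    rw [← lintegral_steinMass, hμS, lintegral_smul_measure, ← lintegral_steinMass,
      ← lintegral_add_compl _ hSm]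
    have h5 : ∫⁻ y in Sᶜ, steinMass μ y = 0 := by
      rw [← withDensity_apply _ hSm.compl, ← hk.withDensity_eq, withDensity_apply _ hSm.compl]
      refine (setLIntegral_congr_fun (g := 0) hSm.compl fun x hx => ?_).trans (by simp)
      rw [gStar, Set.indicator_of_notMem hx, ENNReal.ofReal_zero, Pi.zero_apply]
    rw [h5, add_zero, smul_eq_mul, ← lintegral_const_mul _ (measurable_steinMass ν)]
    refine (setLIntegral_mono' hSm fun x hx => ?_).trans (setLIntegral_le_lintegral S _)
    rw [steinMass_eq_ofReal hiμ h0μ, steinMass_eq_ofReal hi h0, ← ENNReal.ofReal_mul hc0,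
      ← hc x hx, div_mul_cancel₀ _ (hψpos hx).ne']
  have hfin : ∫⁻ x in S, ‖x‖ₑ ^ 2 ∂μ ≠ ∞ := by
    refine ((setLIntegral_le_lintegral S _).trans_lt ?_).ne
    have := h2μ.hasFiniteIntegral
    simp only [HasFiniteIntegral, enorm_pow] at this
    exact this
  have hcompl : ∫⁻ x in Sᶜ, ‖x‖ₑ ^ 2 ∂μ = 0 := by
    rw [← lintegral_add_compl _ hSm] at hsq
    by_contra hne
    exact absurd hsq (not_le.2 (ENNReal.lt_add_right hfin hne))
  -- A vanishing second moment off `S` leaves room only for an atom at 0, but 0 belongs to `S`.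
  have hμSc : μ Sᶜ = 0 := by
    rw [lintegral_eq_zero_iff (by fun_prop), EventuallyEq, ae_restrict_iff' hSm.compl] at hcompl
    refine measure_eq_zero_iff_ae_notMem.2 ?_
    filter_upwards [hcompl] with x hx hxS
    have h6 := hx hxS
    have h7 : x = 0 := by simpa using h6
    exact hxS (h7 ▸ h.zero_mem)
  have hμ : μ = ENNReal.ofReal c • ν := by
    rw [← hμS]; exact (Measure.restrict_eq_self_of_ae_mem hμSc).symm
  have hc1 : ENNReal.ofReal c = 1 := by
    have := congrArg (fun m => m Set.univ) hμ
    simpa using this.symm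
  rw [hμ, hc1, one_smul]

end Identification

/-! ### The three moment conditions as a vanishing square -/

section Characterization

variable {ν μ : Measure ℝ} {l u : EReal} {ρ G γ γ' : ℝ → ℝ}

lemma lintegral_kernel_mul [SFinite μ] {g : ℝ → ℝ} (hg : Measurable g) (hγ : IsSteinKernel μ γ) :
    ∫⁻ x, ENNReal.ofReal (γ x) * ENNReal.ofReal (g x) ∂μ =
      ∫⁻ y, ENNReal.ofReal (g y) * steinMass μ y := by
  have h1 := congrArg (fun m => ∫⁻ x, ENNReal.ofReal (g x) ∂m) hγ.withDensity_eq
  beta_reduce at h1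
  rw [lintegral_withDensity_eq_lintegral_mul _ hγ.measurable.ennreal_ofReal hg.ennreal_ofReal,
    lintegral_withDensity_eq_lintegral_mul _ (measurable_steinMass μ) hg.ennreal_ofReal] at h1
  simpa [mul_comm] using h1

/-- `E[X (G(X) - G(0))] = E[γ(X) g(X)]`, both sides being integrable at the same time. -/
lemma integrable_mul_antideriv_iff [IsFiniteMeasure μ] {g : ℝ → ℝ} (hgm : Measurable g)
    (hg : ∀ x, 0 ≤ g x) (hG : IsAntideriv G g) (hγ : IsSteinKernel μ γ)
    (hGm : Measurable G) :
    (Integrable (fun x => x * (G x - G 0)) μ ↔ Integrable (fun x => γ x * g x) μ) ∧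
      ∫ x, x * (G x - G 0) ∂μ = ∫ x, γ x * g x ∂μ := by
  obtain ⟨h1, h2⟩ := lintegral_mul_steinMass_antideriv μ hgm hg hG
  have h3 : ∫⁻ x, ENNReal.ofReal (x * (G x - G 0)) ∂μ = ∫⁻ x, ENNReal.ofReal (γ x * g x) ∂μ := by
    rw [← h1, ← lintegral_kernel_mul hgm hγ]
    simp_rw [ENNReal.ofReal_mul (hγ.nonneg _)]
  have h4 : ∀ x, 0 ≤ γ x * g x := fun x => mul_nonneg (hγ.nonneg x) (hg x)
  have m1 : AEStronglyMeasurable (fun x => x * (G x - G 0)) μ :=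
    (measurable_id.mul (hGm.sub_const _)).aestronglyMeasurable
  have m2 : AEStronglyMeasurable (fun x => γ x * g x) μ :=
    (hγ.measurable.mul hgm).aestronglyMeasurable
  constructor
  · rw [← lintegral_ofReal_ne_top_iff_integrable m1 (ae_of_all _ h2),
      ← lintegral_ofReal_ne_top_iff_integrable m2 (ae_of_all _ h4), h3]
  · rw [integral_eq_lintegral_of_nonneg_ae (ae_of_all _ h2) m1,
      integral_eq_lintegral_of_nonneg_ae (ae_of_all _ h4) m2, h3]

lemma IsAntideriv.continuous {g : ℝ → ℝ} (hG : IsAntideriv G g) : Continuous G := by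
  have h : G = fun x => G 0 + ∫ y in (0 : ℝ)..x, g y := by
    ext x; rw [(hG 0 x).2]; ring
  rw [h]
  exact continuous_const.add
    (intervalIntegral.continuous_primitive (fun a b => (hG a b).1) 0)

/-- The characterization of the target law on the level of laws. -/
theorem IsTargetLaw.eq_iff [IsProbabilityMeasure μ] [IsProbabilityMeasure ν]
    (h : IsTargetLaw ν l u ρ) (hi : Integrable id ν) (h0 : ∫ x, x ∂ν = 0)
    (hγ' : IsSteinKernel ν γ')
    (hiμ : Integrable id μ) (h0μ : ∫ x, x ∂μ = 0) (h2μ : Integrable (fun x => x ^ 2) μ)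
    (hγ : IsSteinKernel μ γ)
    (hN : (∃ M : ℝ, ∀ x, |gStar ρ l u x| ≤ M) ∨ μ ≪ volume)
    (hfin : Integrable (fun x => gStar ρ l u x ^ 2) ν) (hG : IsAntideriv G (gStar ρ l u)) :
    μ = ν ↔
      (Integrable (fun x => gStar ρ l u x ^ 2) μ ∧
        ∫ x, gStar ρ l u x ^ 2 ∂μ = ∫ x, gStar ρ l u x ^ 2 ∂ν) ∧
      (Integrable (fun x => x * G x) μ ∧ ∫ x, x * G x ∂μ = ∫ x, x * G x ∂ν) ∧
      (Integrable (fun x => γ x ^ 2) μ ∧ ∫ x, γ x ^ 2 ∂μ = ∫ x, γ' x ^ 2 ∂ν) := by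
  set g := gStar ρ l u with hg
  have hgm : Measurable g := h.measurable_gStar hi h0
  have hg0 : ∀ x, 0 ≤ g x := h.gStar_nonneg hi h0
  have hGm := hG.continuous.measurable
  have hk := h.kernel_eq hi h0 hγ'
  have hiμ' : Integrable (fun x : ℝ => x) μ := hiμ
  have hi' : Integrable (fun x : ℝ => x) ν := hi
  -- replacing `G` by `G - G 0`
  have hsplit : ∀ {m : Measure ℝ}, Integrable (fun x : ℝ => x) m → ∫ x, x ∂m = 0 →
      (Integrable (fun x => x * G x) m ↔ Integrable (fun x => x * (G x - G 0)) m) ∧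
      (Integrable (fun x => x * G x) m → ∫ x, x * (G x - G 0) ∂m = ∫ x, x * G x ∂m) := by
    intro m hm hm0
    have e1 : (fun x => x * (G x - G 0)) = fun x => x * G x - x * G 0 := by ext; ring
    refine ⟨⟨fun hI => e1 ▸ hI.sub (hm.mul_const _), fun hI => ?_⟩, fun hI => ?_⟩
    · refine (hI.add (hm.mul_const (G 0))).congr (ae_of_all _ fun x => ?_)
      simp only [Pi.add_apply]; ring
    · rw [e1, integral_sub hI (hm.mul_const _), integral_mul_const, hm0]; ring
  have hγ'g : (fun x => γ' x * g x) =ᵐ[ν] fun x => g x ^ 2 := by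
    filter_upwards [hk] with x hx
    rw [hx, sq]
  have hIν : Integrable (fun x => x * G x) ν := by
    rw [(hsplit hi' h0).1, (integrable_mul_antideriv_iff hgm hg0 hG hγ' hGm).1]
    exact hfin.congr hγ'g.symm
  have hEν : ∫ x, x * G x ∂ν = ∫ x, g x ^ 2 ∂ν := by
    rw [← (hsplit hi' h0).2 hIν, (integrable_mul_antideriv_iff hgm hg0 hG hγ' hGm).2]
    exact integral_congr_ae hγ'g
  have hsqν : ∫ x, γ' x ^ 2 ∂ν = ∫ x, g x ^ 2 ∂ν :=
    integral_congr_ae (by filter_upwards [hk] with x hx; rw [hx])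
  constructor
  · rintro rfl
    have hk' : (fun x => γ x ^ 2) =ᵐ[μ] fun x => g x ^ 2 := by
      filter_upwards [h.kernel_eq hi h0 hγ] with x hx; rw [hx]
    exact ⟨⟨hfin, rfl⟩, ⟨hIν, rfl⟩, hfin.congr hk'.symm, by rw [hsqν]; exact integral_congr_ae hk'⟩
  · rintro ⟨⟨i1, e1⟩, ⟨i2, e2⟩, i3, e3⟩
    have hGμ := integrable_mul_antideriv_iff hgm hg0 hG hγ hGm
    have i4 : Integrable (fun x => γ x * g x) μ := hGμ.1.1 ((hsplit hiμ' h0μ).1.1 i2)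
    have e4 : ∫ x, γ x * g x ∂μ = ∫ x, g x ^ 2 ∂ν := by
      rw [← hGμ.2, (hsplit hiμ' h0μ).2 i2, e2, hEν]
    -- By the three conditions the expanded square is A + A - 2A, where A is the integral of g²
    -- under `ν`.
    have e5 : ∫ x, (γ x - g x) ^ 2 ∂μ = 0 := by
      have : (fun x => (γ x - g x) ^ 2) = fun x => γ x ^ 2 + g x ^ 2 - 2 * (γ x * g x) := by
        ext; ring
      rw [this, integral_sub (f := fun x => γ x ^ 2 + g x ^ 2) (i3.add i1) (i4.const_mul 2),
        integral_add i3 i1,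
        integral_const_mul, e1, e3, e4, hsqν]
      ring
    have i5 : Integrable (fun x => (γ x - g x) ^ 2) μ := by
      refine ((i3.add i1).sub (i4.const_mul 2)).congr (ae_of_all _ fun x => ?_)
      simp only [Pi.add_apply, Pi.sub_apply]; ring
    have hae : γ =ᵐ[μ] g := by
      filter_upwards [(integral_eq_zero_iff_of_nonneg (fun x => sq_nonneg _) i5).1 e5] with x hx
      have : γ x - g x = 0 := by simpa using hx
      linarith
    refine h.eq_of_kernel hi h0 hγ' hiμ h0μ h2μ ⟨hgm, hg0, ?_⟩ ?_
    · rw [← hγ.withDensity_eq]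
      refine withDensity_congr_ae ?_
      filter_upwards [hae] with x hx
      rw [hx]
    -- The zeros of ρ in (l, u) do not exist if g_* is bounded, and form a Lebesgue-null set in any
    -- case.
    · rcases hN with ⟨M, hM⟩ | hN
      · convert measure_empty (μ := μ)
        refine Set.eq_empty_of_forall_notMem fun x hx => ?_
        exact (h.density_pos_of_bounded hi h0 hγ' hM hx.1).ne' hx.2
      · refine hN (measure_eq_zero_iff_ae_notMem.2 ?_)
        filter_upwards [h.density_pos hi h0 hγ'] with x hx hx'
        exact (hx hx'.1).ne' hx'.2

end Characterization

/-! ### Functions of polynomial growth under Gaussian measures -/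

section Temperate

variable {E F : Type*} [NormedAddCommGroup E] [NormedSpace ℝ E] [NormedAddCommGroup F]
  [NormedSpace ℝ F]

lemma Function.HasTemperateGrowth.fderiv {f : E → F} (hf : f.HasTemperateGrowth) :
    (fderiv ℝ f).HasTemperateGrowth := by
  refine ⟨hf.1.fderiv_right (by simp), fun n => ?_⟩
  obtain ⟨k, C, h⟩ := hf.2 (n + 1)
  exact ⟨k, C, fun x => by rw [norm_iteratedFDeriv_fderiv]; exact h x⟩

lemma Function.HasTemperateGrowth.fderiv_apply {f : E → F} (hf : f.HasTemperateGrowth) (v : E) :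
    (fun x => _root_.fderiv ℝ f x v).HasTemperateGrowth :=
  (ContinuousLinearMap.apply ℝ F v).hasTemperateGrowth.comp hf.fderiv

lemma Function.HasTemperateGrowth.differentiable {f : E → F} (hf : f.HasTemperateGrowth) :
    Differentiable ℝ f := hf.1.differentiable (by simp)

lemma Function.HasTemperateGrowth.continuous {f : E → F} (hf : f.HasTemperateGrowth) :
    Continuous f := hf.1.continuous

/-- Gaussian measures have moments of all orders, and |f| is at most C (1 + ‖x‖)^(k+1). The exponent
is raised from k to k + 1 so that it is nonzero. -/
lemma Function.HasTemperateGrowth.memLp [CompleteSpace E] [SecondCountableTopology E]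
    [MeasurableSpace E] [BorelSpace E] {μ : Measure E} [IsGaussian μ] {f : E → ℝ}
    (hf : f.HasTemperateGrowth) {p : ℝ≥0∞} (hp : p ≠ ∞) : MemLp f p μ := by
  obtain ⟨k, C, h⟩ := hf.2 0
  obtain ⟨q, hq⟩ : ∃ q : ℝ≥0∞, q = ((k + 1 : ℕ) : ℝ≥0∞) := ⟨_, rfl⟩
  have hq0 : q ≠ 0 := by rw [hq]; simp
  have hqt : q ≠ ∞ := by rw [hq]; simp
  have h0 : MemLp (fun x : E => ‖x‖) (p * q) μ :=
    (IsGaussian.memLp_id μ _ (ENNReal.mul_ne_top hp hqt)).norm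
  have h1 : MemLp (fun x : E => 1 + ‖x‖) (p * q) μ := (memLp_const (1 : ℝ)).add h0
  have h2 := h1.norm_rpow_div q
  rw [ENNReal.mul_div_cancel_right hq0 hqt, hq] at h2
  refine (h2.const_mul C).mono hf.continuous.aestronglyMeasurable (ae_of_all _ fun x => ?_)
  have h3 := h x
  rw [norm_iteratedFDeriv_zero] at h3
  have hC : 0 ≤ C := by
    have := (norm_nonneg _).trans h3
    exact nonneg_of_mul_nonneg_left this (by positivity)
  have h4 : (0 : ℝ) ≤ 1 + ‖x‖ := by positivity
  rw [ENNReal.toReal_natCast, Real.rpow_natCast, Real.norm_of_nonneg h4,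
    Real.norm_of_nonneg (mul_nonneg hC (pow_nonneg h4 _))]
  exact h3.trans (mul_le_mul_of_nonneg_left (pow_le_pow_right₀ (by simp) (Nat.le_succ k)) hC)

end Temperate

/-- Gaussian integration by parts on the line. -/
lemma integral_mul_gaussianReal {g : ℝ → ℝ} (hg : g.HasTemperateGrowth) :
    ∫ x, g x * x ∂(gaussianReal 0 1) = ∫ x, deriv g x ∂(gaussianReal 0 1) := by
  have hint : ∀ f : ℝ → ℝ, f.HasTemperateGrowth →
      Integrable (fun x => f x * gaussianPDFReal 0 1 x) := by
    intro f hf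
    have h1 : Integrable f (gaussianReal 0 1) := (hf.memLp ENNReal.one_ne_top).integrable le_rfl
    rw [gaussianReal_of_var_ne_zero _ one_ne_zero, integrable_withDensity_iff
      (measurable_gaussianPDF 0 1) (ae_of_all _ fun x => ENNReal.ofReal_lt_top)] at h1
    simpa only [toReal_gaussianPDF] using h1
  have hd : (deriv g).HasTemperateGrowth := by
    have := hg.fderiv_apply 1
    simpa only [fderiv_apply_one_eq_deriv] using this
  have hpdf : ∀ x, HasDerivAt (gaussianPDFReal 0 1) (-(x * gaussianPDFReal 0 1 x)) x := by
    intro x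
    rw [gaussianPDFReal_def]
    have h1 : HasDerivAt (fun x : ℝ => -(x - 0) ^ 2 / (2 * ((1 : NNReal) : ℝ))) (-x) x := by
      refine ((((hasDerivAt_id x).sub_const 0).pow 2).neg.div_const _).congr_deriv ?_
      simp; ring
    refine (h1.exp.const_mul _).congr_deriv ?_
    ring
  rw [integral_gaussianReal_eq_integral_smul one_ne_zero,
    integral_gaussianReal_eq_integral_smul one_ne_zero]
  have := integral_mul_deriv_eq_deriv_mul_of_integrable (u := g) (v := gaussianPDFReal 0 1)
    (fun x _ => (hg.differentiable x).hasDerivAt) (fun x _ => hpdf x)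
    (by
      refine (hint (fun x => -(g x * x)) (by fun_prop)).congr (ae_of_all _ fun x => ?_)
      simp only [Pi.mul_apply]; ring)
    (hint _ hd) (hint _ hg)
  simp only [smul_eq_mul]
  calc ∫ x, gaussianPDFReal 0 1 x * (g x * x)
      = -∫ x, g x * (-(x * gaussianPDFReal 0 1 x)) := by
        rw [← integral_neg]; congr 1; ext x; ring
    _ = ∫ x, gaussianPDFReal 0 1 x * deriv g x := by
        rw [this, neg_neg]; congr 1; ext x; ring

/-! ### Isonormal processes: linearity, independence, integration by parts -/

section Isonormal

variable {Ω H : Type*} [MeasurableSpace Ω] {P : Measure Ω} [IsProbabilityMeasure P]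
  [NormedAddCommGroup H] [InnerProductSpace ℝ H] {W : H → Ω → ℝ} {ι : Type*} [Fintype ι]

namespace IsIsonormal

lemma aemeasurable (hW : IsIsonormal W P) (h : H) : AEMeasurable (W h) P :=
  hW.gaussian.aemeasurable h

lemma memLp (hW : IsIsonormal W P) (h : H) {p : ℝ≥0∞} (hp : p ≠ ∞) : MemLp (W h) p P :=
  (hW.gaussian.hasGaussianLaw_eval h).memLp hp

lemma hasGaussianLaw (hW : IsIsonormal W P) (a : ι → H) :
    HasGaussianLaw (fun ω i => W (a i) ω) P := by
  classical
  have h1 := (hW.gaussian.comp_right a).hasGaussianLaw Finset.univ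
  let L : (↥(Finset.univ : Finset ι) → ℝ) →L[ℝ] (ι → ℝ) :=
    ContinuousLinearMap.pi fun i =>
      ContinuousLinearMap.proj (⟨i, Finset.mem_univ i⟩ : (Finset.univ : Finset ι))
  exact h1.map_fun L

lemma memLp_comp (hW : IsIsonormal W P) (a : ι → H) {f : (ι → ℝ) → ℝ}
    (hf : f.HasTemperateGrowth) {p : ℝ≥0∞} (hp : p ≠ ∞) :
    MemLp (fun ω => f fun i => W (a i) ω) p P := by
  have h1 := hW.hasGaussianLaw a
  have := h1.isGaussian_map
  exact (memLp_map_measure_iff hf.continuous.aestronglyMeasurable h1.aemeasurable).1 (hf.memLp hp)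

lemma integrable_mul (hW : IsIsonormal W P) (h k : H) : Integrable (fun ω => W h ω * W k ω) P :=
  (hW.memLp h (p := 2) ENNReal.ofNat_ne_top).integrable_mul
    (hW.memLp k (p := 2) ENNReal.ofNat_ne_top)

/-- Linearity of W is a consequence of the covariance: the second moment of the defect expands into
inner products that cancel. -/
lemma ae_eq_add_smul (hW : IsIsonormal W P) (h k : H) (c : ℝ) :
    W (h + c • k) =ᵐ[P] fun ω => W h ω + c * W k ω := by
  have e : (fun ω => (W (h + c • k) ω - (W h ω + c * W k ω)) ^ 2) =
      (fun ω => W (h + c • k) ω * W (h + c • k) ω) - (fun ω => 2 * (W (h + c • k) ω * W h ω))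
        - (fun ω => 2 * c * (W (h + c • k) ω * W k ω)) + (fun ω => W h ω * W h ω)
        + (fun ω => 2 * c * (W h ω * W k ω)) + (fun ω => c ^ 2 * (W k ω * W k ω)) := by
    ext; simp only [Pi.add_apply, Pi.sub_apply]; ring
  have i1 := hW.integrable_mul (h + c • k) (h + c • k)
  have i2 := (hW.integrable_mul (h + c • k) h).const_mul 2
  have i3 := (hW.integrable_mul (h + c • k) k).const_mul (2 * c)
  have i4 := hW.integrable_mul h h
  have i5 := (hW.integrable_mul h k).const_mul (2 * c)
  have i6 := (hW.integrable_mul k k).const_mul (c ^ 2)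
  have hi : Integrable (fun ω => (W (h + c • k) ω - (W h ω + c * W k ω)) ^ 2) P := by
    rw [e]; exact ((((i1.sub i2).sub i3).add i4).add i5).add i6
  have h0 : ∫ ω, (W (h + c • k) ω - (W h ω + c * W k ω)) ^ 2 ∂P = 0 := by
    rw [e, integral_add' ((((i1.sub i2).sub i3).add i4).add i5) i6,
      integral_add' (((i1.sub i2).sub i3).add i4) i5, integral_add' ((i1.sub i2).sub i3) i4,
      integral_sub' (i1.sub i2) i3, integral_sub' i1 i2]
    simp only [integral_const_mul, hW.covariance, inner_add_left, inner_add_right,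
      real_inner_smul_left, real_inner_smul_right, real_inner_comm h k]
    ring
  filter_upwards [(integral_eq_zero_iff_of_nonneg (fun ω => sq_nonneg _) hi).1 h0] with ω hω
  have : W (h + c • k) ω - (W h ω + c * W k ω) = 0 := by simpa using hω
  linarith

lemma ae_eq_sum (hW : IsIsonormal W P) (a : ι → H) (t : ι → ℝ) :
    W (∑ i, t i • a i) =ᵐ[P] fun ω => ∑ i, t i * W (a i) ω := by
  classical
  have h0 : W 0 =ᵐ[P] fun _ => 0 := by
    filter_upwards [hW.ae_eq_add_smul 0 0 1] with ω hω
    simp at hω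
    exact hω
  suffices ∀ s : Finset ι, W (∑ i ∈ s, t i • a i) =ᵐ[P] fun ω => ∑ i ∈ s, t i * W (a i) ω from
    this Finset.univ
  intro s
  induction s using Finset.induction_on with
  | empty => simpa using h0
  | insert i s hi ih =>
    filter_upwards [ih, hW.ae_eq_add_smul (∑ i ∈ s, t i • a i) (a i) (t i)] with ω h1 h2
    rw [Finset.sum_insert hi, Finset.sum_insert hi, add_comm, h2, h1, add_comm]

lemma map_eq_gaussianReal (hW : IsIsonormal W P) {h : H} (hh : ‖h‖ = 1) :
    P.map (W h) = gaussianReal 0 1 := by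
  rw [(hW.gaussian.hasGaussianLaw_eval h).map_eq_gaussianReal, hW.centered h]
  congr 1
  rw [variance_of_integral_eq_zero (hW.aemeasurable h) (hW.centered h)]
  have : ∫ ω, W h ω ^ 2 ∂P = 1 := by
    have := hW.covariance h h
    simp only [← sq] at this
    rw [this, real_inner_self_eq_norm_sq, hh]; norm_num
  rw [this, Real.toNNReal_one]

/-- Uncorrelated jointly Gaussian variables are independent. -/
lemma indepFun (hW : IsIsonormal W P) {h : H} {b : ι → H} (hb : ∀ i, inner ℝ h (b i) = 0) :
    IndepFun (W h) (fun ω i => W (b i) ω) P := by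
  have h1 : IsGaussianProcess (Sum.elim (fun _ : Unit => W h) fun i => W (b i)) P := by
    have := hW.gaussian.comp_right (Sum.elim (fun _ : Unit => h) b)
    have e : Sum.elim (fun _ : Unit => W h) (fun i => W (b i)) =
        W ∘ Sum.elim (fun _ : Unit => h) b := by
      ext x ω; cases x <;> rfl
    rw [e]; exact this
  have h2 := h1.indepFun_of_covariance_eq_zero (fun _ => hW.aemeasurable h)
    (fun i => hW.aemeasurable (b i)) (fun _ i => by
      rw [covariance_eq_sub (hW.memLp h ENNReal.ofNat_ne_top) (hW.memLp _ ENNReal.ofNat_ne_top),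
        hW.centered h, zero_mul, sub_zero]
      exact (hW.covariance h (b i)).trans (hb i))
  exact h2.comp (measurable_pi_apply ()) measurable_id

/-- Gaussian integration by parts. -/
lemma integral_mul_eq_integral_fderiv (hW : IsIsonormal W P) {h : H} (hh : ‖h‖ = 1) (a : ι → H)
    {f : (ι → ℝ) → ℝ} (hf : f.HasTemperateGrowth) :
    ∫ ω, f (fun i => W (a i) ω) * W h ω ∂P =
      ∫ ω, fderiv ℝ f (fun i => W (a i) ω) (fun i => inner ℝ (a i) h) ∂P := by
  -- Split a_i = b_i + v_i h with b_i orthogonal to h. Then W(h) is independent of the W(b_i), and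
  -- the identity reduces to one-dimensional integration by parts along the line y + x v, with y
  -- fixed.
  set v : ι → ℝ := fun i => inner ℝ (a i) h with hv
  set b : ι → H := fun i => a i + (-v i) • h with hb
  have hbh : ∀ i, inner ℝ h (b i) = 0 := fun i => by
    rw [hb, inner_add_right, real_inner_smul_right, real_inner_self_eq_norm_sq, hh,
      real_inner_comm]; simp [hv]
  have hdec : ∀ᵐ ω ∂P, (fun i => W (a i) ω) = (fun i => W (b i) ω) + W h ω • v := by
    filter_upwards [ae_all_iff.2 fun i => hW.ae_eq_add_smul (a i) h (-v i)] with ω hω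
    ext i
    simp only [Pi.add_apply, Pi.smul_apply, smul_eq_mul]
    rw [hb, hω i]; ring
  have mY : AEMeasurable (fun ω i => W (b i) ω) P := (hW.hasGaussianLaw b).aemeasurable
  have mX := hW.aemeasurable h
  set mu := P.map (fun ω i => W (b i) ω) with hmu
  have : IsProbabilityMeasure mu := Measure.isProbabilityMeasure_map mY
  have hprod : P.map (fun ω => (W h ω, fun i => W (b i) ω)) = (gaussianReal 0 1).prod mu := by
    rw [(indepFun_iff_map_prod_eq_prod_map_map mX mY).1 (hW.indepFun hbh),
      hW.map_eq_gaussianReal hh]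
  have key : ∀ q : ℝ × (ι → ℝ) → ℝ, Continuous q →
      Integrable (fun ω => q (W h ω, fun i => W (b i) ω)) P →
      ∫ ω, q (W h ω, fun i => W (b i) ω) ∂P = ∫ y, ∫ x, q (x, y) ∂(gaussianReal 0 1) ∂mu := by
    intro q hq hqi
    have m2 := mX.prodMk mY
    rw [← integral_map (f := q) m2 hq.aestronglyMeasurable, hprod, integral_prod_symm]
    rw [← hprod]
    exact (integrable_map_measure hq.aestronglyMeasurable m2).2 hqi
  have hfd := hf.fderiv_apply v
  have i1 : Integrable (fun ω => f (fun i => W (a i) ω) * W h ω) P :=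
    (hW.memLp_comp a hf (p := 2) ENNReal.ofNat_ne_top).integrable_mul
      (hW.memLp h (p := 2) ENNReal.ofNat_ne_top)
  have i2 : Integrable (fun ω => fderiv ℝ f (fun i => W (a i) ω) v) P :=
    (hW.memLp_comp a hfd ENNReal.one_ne_top).integrable le_rfl
  have e1 : (fun ω => f (fun i => W (a i) ω) * W h ω) =ᵐ[P] fun ω =>
      (fun p : ℝ × (ι → ℝ) => f (p.2 + p.1 • v) * p.1) (W h ω, fun i => W (b i) ω) := by
    filter_upwards [hdec] with ω hω
    rw [hω]
  have e2 : (fun ω => fderiv ℝ f (fun i => W (a i) ω) v) =ᵐ[P] fun ω =>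
      (fun p : ℝ × (ι → ℝ) => fderiv ℝ f (p.2 + p.1 • v) v) (W h ω, fun i => W (b i) ω) := by
    filter_upwards [hdec] with ω hω
    rw [hω]
  have c0 : Continuous fun p : ℝ × (ι → ℝ) => p.2 + p.1 • v := by fun_prop
  rw [integral_congr_ae e1, integral_congr_ae e2,
    key (fun p => f (p.2 + p.1 • v) * p.1) ((hf.continuous.comp c0).mul continuous_fst)
      (i1.congr e1),
    key (fun p => fderiv ℝ f (p.2 + p.1 • v) v) (hfd.continuous.comp c0) (i2.congr e2)]
  refine integral_congr_ae (ae_of_all _ fun y => ?_)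
  have hg : (fun x : ℝ => f (y + x • v)).HasTemperateGrowth := by
    have : (fun x : ℝ => y + x • v).HasTemperateGrowth := by fun_prop
    exact hf.comp this
  refine (integral_mul_gaussianReal hg).trans (integral_congr_ae (ae_of_all _ fun x => ?_))
  have h1 : HasDerivAt (fun x : ℝ => y + x • v) v x := by
    simpa using ((hasDerivAt_id x).smul_const v).const_add y
  exact ((hf.differentiable (y + x • v)).hasFDerivAt.comp_hasDerivAt x h1).deriv

end IsIsonormal

end Isonormal

/-! ### The graph of the Malliavin derivative and its duality with the divergence -/

section Graph

variable {Ω H : Type*} [MeasurableSpace Ω] [NormedAddCommGroup H] [InnerProductSpace ℝ H]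

/-- The graph of the derivative on smooth random variables as a linear subspace. -/
noncomputable def smoothSubmodule (W : H → Ω → ℝ) (P : Measure Ω) :
    Submodule ℝ (Lp ℝ 2 P × Lp H 2 P) where
  carrier := smoothGraph W P
  zero_mem' := by
    refine ⟨0, Fin.elim0, fun _ => 0, .const 0, ?_, ?_⟩
    · exact Lp.coeFn_zero _ _ _
    · filter_upwards [Lp.coeFn_zero H 2 P] with ω hω
      simpa using hω
  add_mem' := by
    rintro p q ⟨n, h, f, hf, hp1, hp2⟩ ⟨m, k, g, hg, hq1, hq2⟩
    let L₁ : (Fin (n + m) → ℝ) →L[ℝ] (Fin n → ℝ) :=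
      ContinuousLinearMap.pi fun i => ContinuousLinearMap.proj (Fin.castAdd m i)
    let L₂ : (Fin (n + m) → ℝ) →L[ℝ] (Fin m → ℝ) :=
      ContinuousLinearMap.pi fun i => ContinuousLinearMap.proj (Fin.natAdd n i)
    have hd : ∀ x v, fderiv ℝ (fun x => f (L₁ x) + g (L₂ x)) x v =
        fderiv ℝ f (L₁ x) (L₁ v) + fderiv ℝ g (L₂ x) (L₂ v) := by
      intro x v
      have d1 := (hf.differentiable (L₁ x)).hasFDerivAt.comp x L₁.hasFDerivAt
      have d2 := (hg.differentiable (L₂ x)).hasFDerivAt.comp x L₂.hasFDerivAt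
      have d3 : fderiv ℝ (fun x => f (L₁ x) + g (L₂ x)) x =
          (fderiv ℝ f (L₁ x)).comp L₁ + (fderiv ℝ g (L₂ x)).comp L₂ := (d1.add d2).fderiv
      rw [d3]; rfl
    have e1 : ∀ ω, L₁ (fun i => W (Fin.append h k i) ω) = fun i => W (h i) ω := fun ω => by
      ext i; simp [L₁]
    have e2 : ∀ ω, L₂ (fun i => W (Fin.append h k i) ω) = fun i => W (k i) ω := fun ω => by
      ext i; simp [L₂]
    have s11 : ∀ i, L₁ (Pi.single (Fin.castAdd m i) 1) = Pi.single i 1 := fun i => by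
      ext j; simp [L₁, Pi.single_apply]
    have s12 : ∀ i, L₁ (Pi.single (Fin.natAdd n i) 1) = 0 := fun i => by
      ext j
      have : Fin.castAdd m j ≠ Fin.natAdd n i := fun h => by
        have := congrArg Fin.val h; simp at this; omega
      simp [L₁, this]
    have s21 : ∀ i, L₂ (Pi.single (Fin.castAdd m i) 1) = 0 := fun i => by
      ext j
      have : Fin.natAdd n j ≠ Fin.castAdd m i := fun h => by
        have := congrArg Fin.val h; simp at this; omega
      simp [L₂, this]
    have s22 : ∀ i, L₂ (Pi.single (Fin.natAdd n i) 1) = Pi.single i 1 := fun i => by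
      ext j; simp [L₂, Pi.single_apply]
    refine ⟨n + m, Fin.append h k, fun x => f (L₁ x) + g (L₂ x),
      (hf.comp L₁.hasTemperateGrowth).add (hg.comp L₂.hasTemperateGrowth), ?_, ?_⟩
    · filter_upwards [Lp.coeFn_add p.1 q.1, hp1, hq1] with ω h1 h2 h3
      rw [Prod.fst_add, h1, Pi.add_apply, h2, h3, e1, e2]
    · filter_upwards [Lp.coeFn_add p.2 q.2, hp2, hq2] with ω h1 h2 h3
      rw [Prod.snd_add, h1, Pi.add_apply, h2, h3, Fin.sum_univ_add]
      simp only [hd, e1, e2, s11, s12, s21, s22, Fin.append_left, Fin.append_right, map_zero,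
        add_zero, zero_add]
  smul_mem' := by
    rintro c p ⟨n, h, f, hf, hp1, hp2⟩
    refine ⟨n, h, fun x => c * f x, (Function.HasTemperateGrowth.const c).mul hf, ?_, ?_⟩
    · filter_upwards [Lp.coeFn_smul c p.1, hp1] with ω h1 h2
      rw [Prod.smul_fst, h1, Pi.smul_apply, h2, smul_eq_mul]
    · filter_upwards [Lp.coeFn_smul c p.2, hp2] with ω h1 h2
      rw [Prod.smul_snd, h1, Pi.smul_apply, h2, Finset.smul_sum]
      refine Finset.sum_congr rfl fun i _ => ?_
      rw [fderiv_const_mul (hf.differentiable _), _root_.smul_apply, smul_assoc]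

/-- The graph of the Malliavin derivative as a closed linear subspace. -/
noncomputable def malliavinSubmodule (W : H → Ω → ℝ) (P : Measure Ω) :
    Submodule ℝ (Lp ℝ 2 P × Lp H 2 P) :=
  (smoothSubmodule W P).topologicalClosure

lemma mem_malliavinSubmodule {W : H → Ω → ℝ} {P : Measure Ω} {p : Lp ℝ 2 P × Lp H 2 P} :
    p ∈ malliavinSubmodule W P ↔ p ∈ malliavinGraph W P := by
  rw [malliavinSubmodule, ← SetLike.mem_coe, Submodule.topologicalClosure_coe]; rfl

lemma isClosed_malliavinSubmodule (W : H → Ω → ℝ) (P : Measure Ω) :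
    IsClosed (malliavinSubmodule W P : Set (Lp ℝ 2 P × Lp H 2 P)) :=
  Submodule.isClosed_topologicalClosure _

lemma malliavinGraph_induction {W : H → Ω → ℝ} {P : Measure Ω}
    {C : Set (Lp ℝ 2 P × Lp H 2 P)} (hC : IsClosed C) (h : smoothGraph W P ⊆ C)
    {p : Lp ℝ 2 P × Lp H 2 P} (hp : p ∈ malliavinGraph W P) : p ∈ C :=
  closure_minimal h hC hp

namespace IsIsonormal

variable {P : Measure Ω} [IsProbabilityMeasure P] {W : H → Ω → ℝ}

/-- Integration by parts applied to the product f k, with the term containing the derivative of k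
moved to the other side. -/
lemma integral_fderiv_mul (hW : IsIsonormal W P) {h : H} (hh : ‖h‖ = 1)
    {n m : ℕ} (a : Fin n → H) (b : Fin m → H) {f : (Fin n → ℝ) → ℝ} {k : (Fin m → ℝ) → ℝ}
    (hf : f.HasTemperateGrowth) (hk : k.HasTemperateGrowth) :
    ∫ ω, fderiv ℝ f (fun i => W (a i) ω) (fun i => inner ℝ (a i) h) *
        k (fun i => W (b i) ω) ∂P =
      ∫ ω, f (fun i => W (a i) ω) * (k (fun i => W (b i) ω) * W h ω -
        fderiv ℝ k (fun i => W (b i) ω) (fun i => inner ℝ (b i) h)) ∂P := by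
  let L₁ : (Fin n ⊕ Fin m → ℝ) →L[ℝ] (Fin n → ℝ) :=
    ContinuousLinearMap.pi fun i => ContinuousLinearMap.proj (Sum.inl i)
  let L₂ : (Fin n ⊕ Fin m → ℝ) →L[ℝ] (Fin m → ℝ) :=
    ContinuousLinearMap.pi fun i => ContinuousLinearMap.proj (Sum.inr i)
  have hd : ∀ x v, fderiv ℝ (fun x => f (L₁ x) * k (L₂ x)) x v =
      f (L₁ x) * fderiv ℝ k (L₂ x) (L₂ v) + fderiv ℝ f (L₁ x) (L₁ v) * k (L₂ x) := by
    intro x v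
    have d1 := (hf.differentiable (L₁ x)).hasFDerivAt.comp x L₁.hasFDerivAt
    have d2 := (hk.differentiable (L₂ x)).hasFDerivAt.comp x L₂.hasFDerivAt
    have d3 : fderiv ℝ (fun x => f (L₁ x) * k (L₂ x)) x =
        f (L₁ x) • (fderiv ℝ k (L₂ x)).comp L₂ + k (L₂ x) • (fderiv ℝ f (L₁ x)).comp L₁ :=
      (d1.mul d2).fderiv
    rw [d3]
    simp only [_root_.add_apply, _root_.smul_apply,
      ContinuousLinearMap.comp_apply, smul_eq_mul]
    ring
  have key := hW.integral_mul_eq_integral_fderiv hh (Sum.elim a b)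
    ((hf.comp L₁.hasTemperateGrowth).mul (hk.comp L₂.hasTemperateGrowth))
  have m1 := hW.memLp_comp a hf (p := 2) ENNReal.ofNat_ne_top
  have m2 := hW.memLp_comp a (hf.fderiv_apply fun i => inner ℝ (a i) h) (p := 2)
    ENNReal.ofNat_ne_top
  have m3 := hW.memLp_comp b hk (p := 2) ENNReal.ofNat_ne_top
  have m4 := hW.memLp_comp b (hk.fderiv_apply fun i => inner ℝ (b i) h) (p := 2)
    ENNReal.ofNat_ne_top
  have m5 : Integrable (fun ω => f (fun i => W (a i) ω) * k (fun i => W (b i) ω) * W h ω) P :=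
    MemLp.integrable_mul (p := 2) (q := 2)
      ((hW.memLp_comp b hk (p := 4) ENNReal.ofNat_ne_top).mul
        (hW.memLp_comp a hf (p := 4) ENNReal.ofNat_ne_top) (hpqr := ⟨by
          rw [← ENNReal.toReal_eq_toReal_iff' (by simp) (by simp), ENNReal.toReal_add (by simp)
            (by simp)]; norm_num⟩))
      (hW.memLp h (p := 2) ENNReal.ofNat_ne_top)
  have i1 : Integrable (fun ω => f (fun i => W (a i) ω) *
      fderiv ℝ k (fun i => W (b i) ω) (fun i => inner ℝ (b i) h)) P := m1.integrable_mul m4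
  have i2 : Integrable (fun ω => fderiv ℝ f (fun i => W (a i) ω) (fun i => inner ℝ (a i) h) *
      k (fun i => W (b i) ω)) P := m2.integrable_mul m3
  have e1 : ∀ ω, L₁ (fun i => W (Sum.elim a b i) ω) = fun i => W (a i) ω := fun ω => rfl
  have e2 : ∀ ω, L₂ (fun i => W (Sum.elim a b i) ω) = fun i => W (b i) ω := fun ω => rfl
  have e3 : L₁ (fun i => inner ℝ (Sum.elim a b i) h) = fun i => inner ℝ (a i) h := rfl
  have e4 : L₂ (fun i => inner ℝ (Sum.elim a b i) h) = fun i => inner ℝ (b i) h := rfl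
  have key2 : ∫ ω, f (fun i => W (a i) ω) * k (fun i => W (b i) ω) * W h ω ∂P =
      ∫ ω, (f (fun i => W (a i) ω) *
        fderiv ℝ k (fun i => W (b i) ω) (fun i => inner ℝ (b i) h) +
        fderiv ℝ f (fun i => W (a i) ω) (fun i => inner ℝ (a i) h) *
        k (fun i => W (b i) ω)) ∂P := by
    refine Eq.trans key (integral_congr_ae (ae_of_all _ fun ω => ?_))
    exact (hd _ _)
  rw [integral_add i1 i2] at key2
  have e5 : (fun ω => f (fun i => W (a i) ω) * (k (fun i => W (b i) ω) * W h ω -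
        fderiv ℝ k (fun i => W (b i) ω) (fun i => inner ℝ (b i) h))) = fun ω =>
      f (fun i => W (a i) ω) * k (fun i => W (b i) ω) * W h ω - f (fun i => W (a i) ω) *
        fderiv ℝ k (fun i => W (b i) ω) (fun i => inner ℝ (b i) h) := by ext; ring
  rw [e5, integral_sub m5 i1, key2]
  ring

lemma memLp_smul (hW : IsIsonormal W P) (h : H) {m : ℕ} (b : Fin m → H) {k : (Fin m → ℝ) → ℝ}
    (hk : k.HasTemperateGrowth) : MemLp (fun ω => k (fun i => W (b i) ω) • h) 2 P :=
  (ContinuousLinearMap.toSpanSingleton ℝ h).comp_memLp'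
    (hW.memLp_comp b hk ENNReal.ofNat_ne_top)

/-- The divergence of k(W(b)) h has to be in L² so that the duality passes to L² limits; its product
term is handled by Hölder with 1/4 + 1/4 = 1/2. -/
lemma memLp_divergence (hW : IsIsonormal W P) (h : H) {m : ℕ} (b : Fin m → H)
    {k : (Fin m → ℝ) → ℝ} (hk : k.HasTemperateGrowth) :
    MemLp (fun ω => k (fun i => W (b i) ω) * W h ω -
        fderiv ℝ k (fun i => W (b i) ω) (fun i => inner ℝ (b i) h)) 2 P :=
  MemLp.sub ((hW.memLp h (p := 4) ENNReal.ofNat_ne_top).mul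
        (hW.memLp_comp b hk (p := 4) ENNReal.ofNat_ne_top) (hpqr := ⟨by
          rw [← ENNReal.toReal_eq_toReal_iff' (by simp) (by simp), ENNReal.toReal_add (by simp)
            (by simp)]; norm_num⟩))
    (hW.memLp_comp b (hk.fderiv_apply _) ENNReal.ofNat_ne_top)

lemma sum_fderiv_mul {n : ℕ} (f : (Fin n → ℝ) → ℝ) (x v : Fin n → ℝ) :
    ∑ i, fderiv ℝ f x (Pi.single i 1) * v i = fderiv ℝ f x v := by
  conv_rhs => rw [← Finset.univ_sum_single v, map_sum]
  refine Finset.sum_congr rfl fun i _ => ?_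
  have : (Pi.single i (v i) : Fin n → ℝ) = v i • Pi.single i 1 := by
    rw [← Pi.single_smul, smul_eq_mul, mul_one]
  rw [this, map_smul, smul_eq_mul, mul_comm]

/-- The duality between the Malliavin derivative and the divergence of `k(W(b)) h`. -/
lemma inner_deriv_eq_inner_divergence (hW : IsIsonormal W P) {h : H} (hh : ‖h‖ = 1)
    {m : ℕ} (b : Fin m → H) {k : (Fin m → ℝ) → ℝ} (hk : k.HasTemperateGrowth)
    {p : Lp ℝ 2 P × Lp H 2 P} (hp : p ∈ malliavinGraph W P) :
    inner ℝ p.2 (hW.memLp_smul h b hk).toLp = inner ℝ p.1 (hW.memLp_divergence h b hk).toLp := by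
  refine malliavinGraph_induction
    (C := {p | inner ℝ p.2 (hW.memLp_smul h b hk).toLp =
      inner ℝ p.1 (hW.memLp_divergence h b hk).toLp}) (isClosed_eq (by fun_prop) (by fun_prop))
    ?_ hp
  rintro q ⟨n, a, f, hf, h1, h2⟩
  simp only [Set.mem_ofPred_eq, L2.inner_def]
  rw [integral_congr_ae (g := fun ω => fderiv ℝ f (fun i => W (a i) ω)
      (fun i => inner ℝ (a i) h) * k (fun i => W (b i) ω)), hW.integral_fderiv_mul hh a b hf hk]
  · refine integral_congr_ae ?_
    filter_upwards [h1, (hW.memLp_divergence h b hk).coeFn_toLp] with ω e1 e2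
    rw [e1, e2, RCLike.inner_apply, conj_trivial, mul_comm]
  · filter_upwards [h2, (hW.memLp_smul h b hk).coeFn_toLp] with ω e1 e2
    rw [e1, e2, sum_inner, ← sum_fderiv_mul, Finset.sum_mul]
    refine Finset.sum_congr rfl fun i _ => ?_
    rw [real_inner_smul_left, real_inner_smul_right]; ring

end IsIsonormal

end Graph

/-! ### Hermite polynomials and their differential equation -/

section Hermite
open Polynomial

lemma Polynomial.hasTemperateGrowth_eval (p : ℝ[X]) :
    (fun x : ℝ => p.eval x).HasTemperateGrowth := by
  simp_rw [eval_eq_sum_range]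
  fun_prop

lemma derivative_hermite_succ (n : ℕ) :
    derivative (hermite (n + 1)) = ((n + 1 : ℕ) : ℤ[X]) * hermite n := by
  induction n with
  | zero => simp
  | succ n ih =>
    rw [hermite_succ (n + 1), derivative_sub, derivative_mul, ih, derivative_mul,
      derivative_natCast, hermite_succ n]
    push_cast
    simp
    ring

/-- This is the source of the eigenvalue n: x p' - p'' is the one-dimensional operator D*D applied
to p. -/
lemma X_mul_derivative_hermite (n : ℕ) :
    X * derivative (hermite n) - derivative (derivative (hermite n)) = (n : ℤ[X]) * hermite n := by
  cases n with
  | zero => simp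
  | succ n =>
    rw [derivative_hermite_succ, derivative_mul, derivative_natCast, hermite_succ n]
    ring

/-- The Hermite polynomial with real coefficients. -/
noncomputable def hermiteR (n : ℕ) : ℝ[X] := (hermite n).map (Int.castRingHom ℝ)

lemma eval_hermiteR (n : ℕ) (x : ℝ) : (hermiteR n).eval x = aeval x (hermite n) := by
  rw [hermiteR, eval_map, aeval_def]; rfl

lemma hermiteR_eq (n : ℕ) (x : ℝ) :
    (derivative (hermiteR n)).eval x * x - (derivative (derivative (hermiteR n))).eval x =
      n * (hermiteR n).eval x := by
  have h := congrArg (fun p => (p.map (Int.castRingHom ℝ)).eval x) (X_mul_derivative_hermite n)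
  simp only [Polynomial.map_sub, Polynomial.map_mul, map_X, ← derivative_map, eval_sub, eval_mul,
    eval_X, Polynomial.map_natCast, eval_natCast] at h
  rw [hermiteR, mul_comm]
  exact h

lemma Polynomial.hasTemperateGrowth_eval_proj (p : ℝ[X]) :
    (fun x : Fin 1 → ℝ => p.eval (x 0)).HasTemperateGrowth :=
  p.hasTemperateGrowth_eval.comp (ContinuousLinearMap.proj (R := ℝ) (φ := fun _ : Fin 1 => ℝ)
    0).hasTemperateGrowth

lemma Polynomial.fderiv_eval_proj (p : ℝ[X]) (x v : Fin 1 → ℝ) :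
    fderiv ℝ (fun x : Fin 1 → ℝ => p.eval (x 0)) x v = (derivative p).eval (x 0) * v 0 := by
  have h1 : HasFDerivAt (fun x : Fin 1 → ℝ => x 0)
      (ContinuousLinearMap.proj (R := ℝ) (φ := fun _ : Fin 1 => ℝ) 0) x :=
    (ContinuousLinearMap.proj (R := ℝ) (φ := fun _ : Fin 1 => ℝ) 0).hasFDerivAt
  have h2 := (p.hasDerivAt (x 0)).comp_hasFDerivAt x h1
  have h3 : fderiv ℝ (fun x : Fin 1 → ℝ => p.eval (x 0)) x = (derivative p).eval (x 0) •
      (ContinuousLinearMap.proj (R := ℝ) (φ := fun _ : Fin 1 => ℝ) 0) := h2.fderiv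
  rw [h3]; rfl

end Hermite

/-! ### Eigenspaces of T*T for a closed operator given by its graph -/

section Eigenspaces

variable {E K : Type*} [NormedAddCommGroup E] [InnerProductSpace ℝ E]
  [NormedAddCommGroup K] [InnerProductSpace ℝ K]

/-- For an operator with graph `𝒢` and a real `c`, the space of the `V` in its domain with
`⟪T G, T V⟫ = c ⟪G, V⟫` for all `G` in the domain, that is, the eigenspace of `T* T`. -/
def eigenGraph (𝒢 : Submodule ℝ (E × K)) (c : ℝ) : Submodule ℝ (E × K) where
  carrier := {p | p ∈ 𝒢 ∧ ∀ q ∈ 𝒢, inner ℝ q.2 p.2 = c * inner ℝ q.1 p.1}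
  zero_mem' := ⟨𝒢.zero_mem, fun q _ => by simp⟩
  add_mem' := by
    rintro p p' ⟨h1, h2⟩ ⟨h3, h4⟩
    refine ⟨𝒢.add_mem h1 h3, fun q hq => ?_⟩
    rw [Prod.snd_add, Prod.fst_add, inner_add_right, inner_add_right, h2 q hq, h4 q hq]; ring
  smul_mem' := by
    rintro a p ⟨h1, h2⟩
    refine ⟨𝒢.smul_mem a h1, fun q hq => ?_⟩
    rw [Prod.smul_snd, Prod.smul_fst, real_inner_smul_right, real_inner_smul_right, h2 q hq]; ring

variable {𝒢 : Submodule ℝ (E × K)}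

lemma norm_snd_sq_eigenGraph {c : ℝ} {p : E × K} (hp : p ∈ eigenGraph 𝒢 c) :
    ‖p.2‖ ^ 2 = c * ‖p.1‖ ^ 2 := by
  have := hp.2 p hp.1
  rwa [real_inner_self_eq_norm_sq, real_inner_self_eq_norm_sq] at this

/-- The form ⟪T p, T q⟫ is symmetric, so it equals both c⟪p, q⟫ and d⟪p, q⟫. -/
lemma inner_eq_zero_of_eigenGraph {c d : ℝ} (hcd : c ≠ d) {p q : E × K}
    (hp : p ∈ eigenGraph 𝒢 c) (hq : q ∈ eigenGraph 𝒢 d) : inner ℝ p.1 q.1 = (0 : ℝ) := by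
  have h1 := hp.2 q hq.1
  have h2 := hq.2 p hp.1
  rw [real_inner_comm, real_inner_comm p.1] at h1
  have : (c - d) * inner ℝ p.1 q.1 = 0 := by linarith
  exact (mul_eq_zero.1 this).resolve_left (sub_ne_zero.2 hcd)

lemma isClosed_eigenGraph (h𝒢 : IsClosed (𝒢 : Set (E × K))) (c : ℝ) :
    IsClosed (eigenGraph 𝒢 c : Set (E × K)) := by
  have : (eigenGraph 𝒢 c : Set (E × K)) =
      (𝒢 : Set (E × K)) ∩ ⋂ q ∈ 𝒢, {p | inner ℝ q.2 p.2 = c * inner ℝ q.1 p.1} := by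
    ext p; simp [eigenGraph]
  rw [this]
  exact h𝒢.inter (isClosed_biInter fun q _ => isClosed_eq (by fun_prop) (by fun_prop))

/-- The eigenspaces are closed. -/
lemma closure_subset_fst_eigenGraph [CompleteSpace K]
    (h𝒢 : IsClosed (𝒢 : Set (E × K))) (c : ℝ) {S : Submodule ℝ E}
    (hS : ∀ V ∈ S, ∃ U, (V, U) ∈ eigenGraph 𝒢 c) {V : E} (hV : V ∈ S.topologicalClosure) :
    ∃ U, (V, U) ∈ eigenGraph 𝒢 c := by
  rw [← SetLike.mem_coe, Submodule.topologicalClosure_coe, mem_closure_iff_seq_limit] at hV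
  obtain ⟨v, hv, hlim⟩ := hV
  choose u hu using fun n => hS (v n) (hv n)
  -- On the eigenspace ‖T V‖² = c‖V‖², so convergence of the vectors forces convergence of their
  -- images.
  have hc : CauchySeq u := by
    rw [Metric.cauchySeq_iff']
    intro ε hε
    obtain ⟨N, hN⟩ := Metric.cauchySeq_iff'.1 hlim.cauchySeq (ε / (|c| + 1)) (by positivity)
    refine ⟨N, fun n hn => ?_⟩
    have h1 := norm_snd_sq_eigenGraph (Submodule.sub_mem _ (hu n) (hu N))
    have h2 := hN n hn
    rw [dist_eq_norm] at h2 ⊢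
    simp only [Prod.snd_sub, Prod.fst_sub] at h1
    rw [lt_div_iff₀ (by positivity)] at h2
    have h3 : ‖u n - u N‖ ^ 2 < ε ^ 2 := by
      calc ‖u n - u N‖ ^ 2 = c * ‖v n - v N‖ ^ 2 := h1
        _ ≤ (|c| + 1) ^ 2 * ‖v n - v N‖ ^ 2 := by
          gcongr
          nlinarith [le_abs_self c, abs_nonneg c]
        _ = (‖v n - v N‖ * (|c| + 1)) ^ 2 := by ring
        _ < ε ^ 2 := by gcongr
    exact lt_of_pow_lt_pow_left₀ 2 hε.le h3
  obtain ⟨U, hU⟩ := cauchySeq_tendsto_of_complete hc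
  exact ⟨U, (isClosed_eigenGraph h𝒢 c).mem_of_tendsto (hlim.prodMk_nhds hU)
    (Eventually.of_forall hu)⟩

lemma sum_norm_sq_of_orthogonal {x : ℕ → E} (h : ∀ q r, q ≠ r → inner ℝ (x q) (x r) = (0 : ℝ))
    (s : Finset ℕ) : ‖∑ q ∈ s, x q‖ ^ 2 = ∑ q ∈ s, ‖x q‖ ^ 2 := by
  rw [← real_inner_self_eq_norm_sq, sum_inner]
  refine Finset.sum_congr rfl fun q hq => ?_
  rw [inner_sum, Finset.sum_eq_single_of_mem q hq fun r _ hrq => h q r hrq.symm,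
    real_inner_self_eq_norm_sq]

lemma summable_of_orthogonal [CompleteSpace E] {x : ℕ → E}
    (h : ∀ q r, q ≠ r → inner ℝ (x q) (x r) = (0 : ℝ)) (hx : Summable fun q => ‖x q‖ ^ 2) :
    Summable x := by
  have horth : OrthogonalFamily ℝ (fun q => ↥(ℝ ∙ x q)) fun q => (ℝ ∙ x q).subtypeₗᵢ := by
    intro q r hqr v w
    obtain ⟨c, hc⟩ := Submodule.mem_span_singleton.1 v.2
    obtain ⟨d, hd⟩ := Submodule.mem_span_singleton.1 w.2
    change inner ℝ (v : E) (w : E) = (0 : ℝ)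
    rw [← hc, ← hd, real_inner_smul_left, real_inner_smul_right, h q r hqr]; simp
  exact (horth.summable_iff_norm_sq_summable
    fun q => ⟨x q, Submodule.mem_span_singleton_self _⟩).2 hx

/-- If the closed subspaces `S q` consist of eigenvectors for `q + 1`, then
`∑ (q + 1)⁻¹ S_q F` is in the domain, and `T` of it represents `G ↦ ⟪G, ∑ S_q F⟫`. -/
theorem exists_pseudoInverse [CompleteSpace E] [CompleteSpace K]
    (h𝒢 : IsClosed (𝒢 : Set (E × K)))
    (S : ℕ → Submodule ℝ E) [∀ q, (S q).HasOrthogonalProjection]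
    (hS : ∀ q : ℕ, ∀ V ∈ S q, ∃ U, (V, U) ∈ eigenGraph 𝒢 (q + 1)) (F : E) :
    Summable (fun q => (S q).starProjection F) ∧
      ∃ U, (∑' q : ℕ, (1 / ((q : ℝ) + 1)) • (S q).starProjection F, U) ∈ 𝒢 ∧
        ∀ p ∈ 𝒢, inner ℝ p.2 U = inner ℝ p.1 (∑' q, (S q).starProjection F) := by
  set x : ℕ → E := fun q => (S q).starProjection F with hx
  have hmem : ∀ q, x q ∈ S q := fun q => Submodule.starProjection_apply_mem _ _
  choose u hu using fun q => hS q _ (hmem q)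
  have hxo : ∀ q r, q ≠ r → inner ℝ (x q) (x r) = (0 : ℝ) := by
    intro q r hqr
    refine inner_eq_zero_of_eigenGraph ?_ (hu q) (hu r)
    intro h'
    have := add_right_cancel h'
    exact hqr (by exact_mod_cast this)
  -- Bessel's inequality: the projections are pairwise orthogonal because they belong to distinct
  -- eigenvalues.
  have hbessel : Summable fun q => ‖x q‖ ^ 2 := by
    refine summable_of_sum_le (c := ‖F‖ ^ 2) (fun q => sq_nonneg _) fun s => ?_
    have h1 : inner ℝ F (∑ q ∈ s, x q) = ∑ q ∈ s, ‖x q‖ ^ 2 := by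
      rw [inner_sum]
      refine Finset.sum_congr rfl fun q _ => ?_
      have := Submodule.starProjection_inner_eq_zero (K := S q) F (x q) (hmem q)
      rw [inner_sub_left, sub_eq_zero] at this
      rw [this]
      exact real_inner_self_eq_norm_sq (x q)
    have h2 := norm_sub_sq_real F (∑ q ∈ s, x q)
    rw [h1, sum_norm_sq_of_orthogonal hxo] at h2
    linarith [sq_nonneg ‖F - ∑ q ∈ s, x q‖]
  have hxs : Summable x := summable_of_orthogonal hxo hbessel
  have hpos : ∀ q : ℕ, (0 : ℝ) < (q : ℝ) + 1 := fun q => by positivity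
  have hle : ∀ q : ℕ, 1 / ((q : ℝ) + 1) ≤ 1 := fun q => by
    rw [div_le_one (hpos q)]; linarith [(Nat.cast_nonneg q : (0 : ℝ) ≤ q)]
  have hys : Summable fun q : ℕ => (1 / ((q : ℝ) + 1)) • x q := by
    refine summable_of_orthogonal (fun q r hqr => ?_) (hbessel.of_nonneg_of_le
      (fun q => sq_nonneg _) fun q => ?_)
    · rw [real_inner_smul_left, real_inner_smul_right, hxo q r hqr]; simp
    · rw [norm_smul, mul_pow, Real.norm_of_nonneg (by positivity)]
      exact mul_le_of_le_one_left (sq_nonneg _) (pow_le_one₀ (by positivity) (hle q))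
  -- Here ‖u_q‖² = (q+1)‖x_q‖², so the weighted terms have squared norm ‖x_q‖²/(q+1). They are
  -- orthogonal because ⟪u_q, u_r⟫ = (r+1)⟪x_q, x_r⟫.
  have hzs : Summable fun q : ℕ => (1 / ((q : ℝ) + 1)) • u q := by
    refine summable_of_orthogonal (fun q r hqr => ?_) (hbessel.of_nonneg_of_le
      (fun q => sq_nonneg _) fun q => ?_)
    · have := (hu r).2 _ (hu q).1
      simp only at this
      rw [real_inner_smul_left, real_inner_smul_right, this, hxo q r hqr]; simp
    · have h1 := norm_snd_sq_eigenGraph (hu q)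
      simp only at h1
      rw [norm_smul, mul_pow, Real.norm_of_nonneg (by positivity), h1, ← mul_assoc]
      refine mul_le_of_le_one_left (sq_nonneg _) ?_
      have : (1 / ((q : ℝ) + 1)) ^ 2 * ((q : ℝ) + 1) = 1 / ((q : ℝ) + 1) := by
        have := hpos q
        field_simp
      rw [this]; exact hle q
  refine ⟨hxs, ∑' q : ℕ, (1 / ((q : ℝ) + 1)) • u q, ?_, fun p hp => ?_⟩
  · refine h𝒢.mem_of_tendsto (hys.hasSum.prodMk hzs.hasSum) (Eventually.of_forall fun s => ?_)
    exact 𝒢.sum_mem fun q _ => 𝒢.smul_mem (1 / ((q : ℝ) + 1)) (hu q).1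
  -- Termwise, the eigenvalue q + 1 cancels the weight 1/(q + 1).
  · have h1 := (innerSL ℝ p.2).hasSum hzs.hasSum
    have h2 := (innerSL ℝ p.1).hasSum hxs.hasSum
    refine h1.unique (h2.congr_fun ?_)
    intro q
    have := (hu q).2 p hp
    simp only at this
    simp only [innerSL_apply_apply, real_inner_smul_right, this]
    have := hpos q
    field_simp

end Eigenspaces

/-! ### Closability of the derivative; the chaoses as eigenspaces -/

section Isonormal

variable {Ω H : Type*} [MeasurableSpace Ω] [NormedAddCommGroup H] [InnerProductSpace ℝ H]
  {P : Measure Ω} [IsProbabilityMeasure P] {W : H → Ω → ℝ}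

namespace IsIsonormal

/-- The derivative on smooth random variables is closable. -/
lemma eq_zero_of_zero_mem (hW : IsIsonormal W P) {U : Lp H 2 P}
    (hU : ((0 : Lp ℝ 2 P), U) ∈ malliavinGraph W P) : U = 0 := by
  -- By duality, a limit of derivatives whose base variables tend to 0 pairs to 0 with every k(W(b))
  -- h.
  have h1 : ∀ (h : H) {n : ℕ} (b : Fin n → H) {k : (Fin n → ℝ) → ℝ} (hk : k.HasTemperateGrowth),
      inner ℝ U (hW.memLp_smul h b hk).toLp = (0 : ℝ) := by
    intro h n b k hk
    rcases eq_or_ne h 0 with rfl | hh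
    · rw [L2.inner_def]
      refine (integral_congr_ae (g := 0) ?_).trans (by simp)
      filter_upwards [(hW.memLp_smul (0 : H) b hk).coeFn_toLp] with ω hω
      rw [hω]; simp
    · have hn : ‖(‖h‖⁻¹ • h)‖ = 1 := by
        rw [norm_smul, norm_inv, norm_norm, inv_mul_cancel₀ (norm_ne_zero_iff.2 hh)]
      have h2 := hW.inner_deriv_eq_inner_divergence hn b hk hU
      have h3 : (hW.memLp_smul h b hk).toLp = ‖h‖ • (hW.memLp_smul (‖h‖⁻¹ • h) b hk).toLp := by
        rw [← MemLp.toLp_const_smul]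
        refine MemLp.toLp_congr _ _ (ae_of_all _ fun ω => ?_)
        simp only [Pi.smul_apply]
        rw [smul_comm, smul_smul ‖h‖, mul_inv_cancel₀ (norm_ne_zero_iff.2 hh), one_smul]
      rw [h3, real_inner_smul_right, h2]
      simp
  -- Derivatives of smooth variables are sums of such elements, and `U` is a limit of them; hence
  -- `U` is orthogonal to itself.
  have h2 : ((0 : Lp ℝ 2 P), U) ∈ {p : Lp ℝ 2 P × Lp H 2 P | inner ℝ U p.2 = (0 : ℝ)} := by
    refine malliavinGraph_induction (isClosed_eq (by fun_prop) (by fun_prop)) ?_ hU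
    rintro q ⟨n, a, f, hf, -, hq⟩
    have : q.2 = ∑ i, (hW.memLp_smul (a i) a (hf.fderiv_apply (Pi.single i 1))).toLp := by
      refine Lp.ext (hq.trans ?_)
      have h4 : ∀ᵐ ω ∂P, ∀ i,
          ((hW.memLp_smul (a i) a (hf.fderiv_apply (Pi.single i 1))).toLp _ : Lp H 2 P) ω =
          fderiv ℝ f (fun j => W (a j) ω) (Pi.single i 1) • a i :=
        ae_all_iff.2 fun i =>
          (hW.memLp_smul (a i) a (hf.fderiv_apply (Pi.single i 1))).coeFn_toLp
      filter_upwards [h4, Lp.coeFn_fun_finsetSum Finset.univ fun i =>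
        (hW.memLp_smul (a i) a (hf.fderiv_apply (Pi.single i 1))).toLp] with ω h5 h6
      rw [h6]
      exact Finset.sum_congr rfl fun i _ => (h5 i).symm
    rw [Set.mem_ofPred_eq, this, inner_sum]
    exact Finset.sum_eq_zero fun i _ => h1 (a i) a (hf.fderiv_apply (Pi.single i 1))
  exact inner_self_eq_zero.1 h2

/-- Closability makes the chosen value unique, so any pair found in the graph computes the
derivative. -/
lemma malliavinDeriv_eq (hW : IsIsonormal W P) {F : Lp ℝ 2 P} {U : Lp H 2 P}
    (hU : (F, U) ∈ malliavinGraph W P) : malliavinDeriv W P F = U := by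
  have hex : ∃ U, (F, U) ∈ malliavinGraph W P := ⟨U, hU⟩
  rw [malliavinDeriv, dif_pos hex]
  have h1 := mem_malliavinSubmodule.2 hex.choose_spec
  have h2 := mem_malliavinSubmodule.1 (Submodule.sub_mem _ h1 (mem_malliavinSubmodule.2 hU))
  rw [Prod.mk_sub_mk, sub_self] at h2
  exact sub_eq_zero.1 (hW.eq_zero_of_zero_mem h2)

/-- The Wiener chaos of order `q` consists of eigenvectors. -/
lemma exists_eigenGraph_of_wienerChaos [CompleteSpace H] (hW : IsIsonormal W P) (q : ℕ)
    {V : Lp ℝ 2 P} (hV : V ∈ wienerChaos W P q) :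
    ∃ U, (V, U) ∈ eigenGraph (malliavinSubmodule W P) (q : ℝ) := by
  refine closure_subset_fst_eigenGraph (isClosed_malliavinSubmodule W P) q ?_ hV
  intro V hV
  have hmap : V ∈ (eigenGraph (malliavinSubmodule W P) (q : ℝ)).map (LinearMap.fst ℝ _ _) := by
    refine Submodule.span_le.2 ?_ hV
    rintro V ⟨h, hh, hVh⟩
    set p := hermiteR q
    have hp := p.hasTemperateGrowth_eval_proj
    have hp' := p.derivative.hasTemperateGrowth_eval_proj
    refine ⟨(V, (hW.memLp_smul h (fun _ : Fin 1 => h) hp').toLp), ⟨?_, ?_⟩, rfl⟩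
    · refine mem_malliavinSubmodule.2 (subset_closure ⟨1, fun _ => h, _, hp, ?_, ?_⟩)
      · filter_upwards [hVh] with ω hω
        rw [hω, eval_hermiteR]
      · filter_upwards [(hW.memLp_smul h (fun _ : Fin 1 => h) hp').coeFn_toLp] with ω hω
        rw [hω, Fin.sum_univ_one, p.fderiv_eval_proj]
        simp
    · intro r hr
      -- The derivative of H_q(W(h)) is H_q'(W(h)) h. For ‖h‖ = 1 its divergence is H_q'(x) x -
      -- H_q''(x) at x = W(h), which is q H_q(W(h)).
      have h1 := hW.inner_deriv_eq_inner_divergence hh (fun _ : Fin 1 => h) hp'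
        (mem_malliavinSubmodule.1 hr)
      refine h1.trans ?_
      rw [← real_inner_smul_right]
      congr 1
      refine Lp.ext ((MemLp.coeFn_toLp _).trans ?_)
      filter_upwards [Lp.coeFn_smul (q : ℝ) V, hVh] with ω h2 h3
      rw [h2, Pi.smul_apply, h3, ← eval_hermiteR, smul_eq_mul, p.derivative.fderiv_eval_proj,
        real_inner_self_eq_norm_sq, hh, ← hermiteR_eq]
      ring
  obtain ⟨⟨V', U⟩, h1, rfl⟩ := hmap
  exact ⟨U, h1⟩

end IsIsonormal

end Isonormal

/-! ### Signed densities as differences of two finite measures -/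

section Signed

variable {Ω : Type*} [MeasurableSpace Ω] {P : Measure Ω}

lemma isFiniteMeasure_withDensity_of_integrable {R : Ω → ℝ} (hR : Integrable R P) :
    IsFiniteMeasure (P.withDensity fun ω => ENNReal.ofReal (R ω)) :=
  isFiniteMeasure_withDensity_ofReal hR.2

lemma integral_withDensity_sub {E : Type*} [NormedAddCommGroup E] [NormedSpace ℝ E]
    [CompleteSpace E] {R : Ω → ℝ} (hR : Measurable R) {g : Ω → E}
    (hg : AEStronglyMeasurable g P) (h : Integrable (fun ω => R ω • g ω) P) :
    (∫ ω, g ω ∂(P.withDensity fun ω => ENNReal.ofReal (R ω))) -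
      (∫ ω, g ω ∂(P.withDensity fun ω => ENNReal.ofReal (-R ω))) = ∫ ω, R ω • g ω ∂P := by
  have h1 : ∀ S : Ω → ℝ, Measurable S → (∀ ω, |S ω| = |R ω|) →
      Integrable (fun ω => (ENNReal.ofReal (S ω)).toReal • g ω) P := by
    intro S hS hSR
    refine h.mono (hS.ennreal_ofReal.ennreal_toReal.aestronglyMeasurable.smul hg)
      (ae_of_all _ fun ω => ?_)
    rw [norm_smul, norm_smul, Real.norm_eq_abs, Real.norm_eq_abs, ← hSR ω]
    refine mul_le_mul_of_nonneg_right ?_ (norm_nonneg _)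
    rw [ENNReal.toReal_ofReal', abs_of_nonneg (le_max_right _ _)]
    exact max_le (le_abs_self _) (abs_nonneg _)
  rw [integral_withDensity_eq_integral_toReal_smul hR.ennreal_ofReal
      (ae_of_all _ fun x => ENNReal.ofReal_lt_top),
    integral_withDensity_eq_integral_toReal_smul (f := fun ω => ENNReal.ofReal (-R ω))
      hR.neg.ennreal_ofReal
      (ae_of_all _ fun x => ENNReal.ofReal_lt_top),
    ← integral_sub (h1 R hR fun ω => rfl) (h1 (fun ω => -R ω) hR.neg fun ω => abs_neg _)]
  refine integral_congr_ae (ae_of_all _ fun ω => ?_)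
  simp only
  rw [← sub_smul, ENNReal.toReal_ofReal', ENNReal.toReal_ofReal']
  congr 1
  rcases le_total 0 (R ω) with h2 | h2
  · rw [max_eq_left h2, max_eq_right (by linarith), sub_zero]
  · rw [max_eq_right h2, max_eq_left (by linarith)]; ring

end Signed

/-! ### Totality of the Hermite polynomials and the pseudo-inverse -/

section Total
open Polynomial

variable {Ω H : Type*} [MeasurableSpace Ω] [NormedAddCommGroup H] [InnerProductSpace ℝ H]
  {P : Measure Ω} [IsProbabilityMeasure P] {W : H → Ω → ℝ}

/-- The Hermite polynomials as a sequence of polynomials with one of each degree. -/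
noncomputable def hermiteSequence : Polynomial.Sequence ℝ where
  elems' := hermiteR
  degree_eq' n := by
    rw [hermiteR, (hermite_monic n).degree_map, degree_hermite]

lemma span_range_hermiteR : Submodule.span ℝ (Set.range hermiteR) = ⊤ :=
  hermiteSequence.span fun i => by
    have : (hermiteSequence i).leadingCoeff = 1 := ((hermite_monic i).map _).leadingCoeff
    rw [this]; exact isUnit_one

namespace IsIsonormal

lemma memLp_eval (hW : IsIsonormal W P) (h : H) (p : ℝ[X]) :
    MemLp (fun ω => p.eval (W h ω)) 2 P :=
  hW.memLp_comp (fun _ : Fin 1 => h) p.hasTemperateGrowth_eval_proj ENNReal.ofNat_ne_top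

lemma memLp_exp (hW : IsIsonormal W P) {h : H} (hh : ‖h‖ = 1) (c : ℝ) :
    MemLp (fun ω => Real.exp |c * W h ω|) 2 P := by
  have hm : AEStronglyMeasurable (fun ω => Real.exp |c * W h ω|) P :=
    ((hW.aemeasurable h).const_mul c).norm.exp.aestronglyMeasurable
  rw [memLp_two_iff_integrable_sq hm]
  have hint : ∀ d : ℝ, Integrable (fun ω => Real.exp (d * W h ω)) P := by
    intro d
    have := integrable_exp_mul_gaussianReal (μ := 0) (v := 1) d
    rw [← hW.map_eq_gaussianReal hh, integrable_map_measure (by fun_prop)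
      (hW.aemeasurable h)] at this
    exact this
  refine ((hint (2 * c)).add (hint (-2 * c))).mono (hm.pow 2) (ae_of_all _ fun ω => ?_)
  rw [← Real.exp_nat_mul, Pi.add_apply, Real.norm_of_nonneg (Real.exp_pos _).le,
    Real.norm_of_nonneg (add_pos (Real.exp_pos _) (Real.exp_pos _)).le]
  rcases abs_cases (c * W h ω) with ⟨h1, -⟩ | ⟨h1, -⟩ <;> rw [h1]
  · refine le_add_of_le_of_nonneg (Real.exp_le_exp.2 (le_of_eq ?_)) (Real.exp_pos _).le
    push_cast; ring
  · refine le_add_of_nonneg_of_le (Real.exp_pos _).le (Real.exp_le_exp.2 (le_of_eq ?_))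
    push_cast; ring

variable {R : Lp ℝ 2 P}

lemma integral_mul_eval_eq_zero (hW : IsIsonormal W P) {h : H}
    (hR : ∀ q, ∫ ω, R ω * (hermiteR q).eval (W h ω) ∂P = 0) (p : ℝ[X]) :
    ∫ ω, R ω * p.eval (W h ω) ∂P = 0 := by
  have hi : ∀ p : ℝ[X], Integrable (fun ω => R ω * p.eval (W h ω)) P := fun p =>
    (Lp.memLp R).integrable_mul (hW.memLp_eval h p)
  have hp : p ∈ Submodule.span ℝ (Set.range hermiteR) := by rw [span_range_hermiteR]; trivial
  induction hp using Submodule.span_induction with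
  | mem x hx => obtain ⟨q, rfl⟩ := hx; exact hR q
  | zero => simp
  | add x y _ _ hx hy =>
    simp only [eval_add, mul_add]
    rw [integral_add (hi x) (hi y), hx, hy, add_zero]
  | smul a x _ hx =>
    simp only [eval_smul, smul_eq_mul, mul_left_comm _ a]
    rw [integral_const_mul, hx, mul_zero]

/-- Orthogonality to the Hermite polynomials gives orthogonality to all polynomials in W(h), hence
to the exponential series term by term; |R| exp|c W(h)| is an integrable dominating function. -/
lemma integral_mul_cexp_eq_zero (hW : IsIsonormal W P) {h : H} (hh : ‖h‖ = 1)
    (hR : ∀ q, ∫ ω, R ω * (hermiteR q).eval (W h ω) ∂P = 0) (c : ℝ) :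
    ∫ ω, R ω • Complex.exp (((c * W h ω : ℝ) : ℂ) * Complex.I) ∂P = 0 := by
  have hRm := Lp.aestronglyMeasurable R
  have hWm := (hW.aemeasurable h).aestronglyMeasurable
  have h1 := hasSum_integral_of_dominated_convergence (μ := P)
    (F := fun (k : ℕ) ω => R ω • ((((c * W h ω : ℝ) : ℂ) * Complex.I) ^ k / (k.factorial : ℂ)))
    (f := fun ω => R ω • Complex.exp (((c * W h ω : ℝ) : ℂ) * Complex.I))
    (bound := fun k ω => |R ω| * (|c * W h ω| ^ k / (k.factorial : ℝ)))
    (fun k => hRm.smul (Continuous.comp_aestronglyMeasurable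
      (g := fun x : ℝ => ((x : ℂ) * Complex.I) ^ k / (k.factorial : ℂ)) (by fun_prop)
      (hWm.const_mul c)))
    (fun k => ae_of_all _ fun ω => by
      rw [norm_smul, norm_div, norm_pow, norm_mul, Complex.norm_I, mul_one, Complex.norm_real,
        Complex.norm_natCast, Real.norm_eq_abs, Real.norm_eq_abs])
    (ae_of_all _ fun ω => (Real.summable_pow_div_factorial _).mul_left _)
    (by
      have : (fun ω => ∑' k : ℕ, |R ω| * (|c * W h ω| ^ k / (k.factorial : ℝ))) =
          fun ω => |R ω| * Real.exp |c * W h ω| := by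
        ext ω
        rw [tsum_mul_left, Real.exp_eq_exp_ℝ, NormedSpace.exp_eq_tsum_div]
      rw [this]
      exact (Lp.memLp R).norm.integrable_mul (hW.memLp_exp hh c))
    (ae_of_all _ fun ω => by
      have := NormedSpace.expSeries_div_hasSum_exp (𝔸 := ℂ) (((c * W h ω : ℝ) : ℂ) * Complex.I)
      rw [← Complex.exp_eq_exp_ℂ] at this
      exact this.const_smul _)
  refine h1.unique ?_
  convert hasSum_zero with k
  have e : (fun ω => R ω • ((((c * W h ω : ℝ) : ℂ) * Complex.I) ^ k / (k.factorial : ℂ))) =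
      fun ω => ((R ω * (X ^ k : ℝ[X]).eval (W h ω) : ℝ) : ℂ) *
        ((c * Complex.I) ^ k / (k.factorial : ℂ)) := by
    ext ω
    simp only [eval_pow, eval_X, Complex.real_smul]
    push_cast
    ring
  rw [e, integral_mul_const, integral_complex_ofReal, hW.integral_mul_eval_eq_zero hR]
  simp

/-- The Hermite polynomials in `W h` are total in the smooth random variables. -/
theorem integral_mul_smooth_eq_zero (hW : IsIsonormal W P) (h0 : ∫ ω, R ω ∂P = 0)
    (hR : ∀ h : H, ‖h‖ = 1 → ∀ q, ∫ ω, R ω * (hermiteR q).eval (W h ω) ∂P = 0)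
    {n : ℕ} (a : Fin n → H) {f : (Fin n → ℝ) → ℝ} (hf : f.HasTemperateGrowth) :
    ∫ ω, R ω * f (fun i => W (a i) ω) ∂P = 0 := by
  have hexp : ∀ h : H, ∫ ω, R ω • Complex.exp (((W h ω : ℝ) : ℂ) * Complex.I) ∂P = 0 := by
    intro h
    rcases eq_or_ne h 0 with rfl | hh
    · have hz : W 0 =ᵐ[P] fun _ => 0 := by
        filter_upwards [hW.ae_eq_add_smul 0 0 1] with ω hω
        simp at hω
        exact hω
      have : (fun ω => R ω • Complex.exp (((W 0 ω : ℝ) : ℂ) * Complex.I)) =ᵐ[P]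
          fun ω => ((R ω : ℝ) : ℂ) := by
        filter_upwards [hz] with ω hω
        rw [hω]; simp
      rw [integral_congr_ae this, integral_complex_ofReal, h0, Complex.ofReal_zero]
    · have hn : ‖(‖h‖⁻¹ • h)‖ = 1 := by
        rw [norm_smul, norm_inv, norm_norm, inv_mul_cancel₀ (norm_ne_zero_iff.2 hh)]
      rw [← hW.integral_mul_cexp_eq_zero hn (hR _ hn) ‖h‖]
      refine integral_congr_ae ?_
      filter_upwards [hW.ae_eq_sum (fun _ : Fin 1 => ‖h‖⁻¹ • h) fun _ => ‖h‖] with ω hω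
      simp only [Fin.sum_univ_one, smul_smul, mul_inv_cancel₀ (norm_ne_zero_iff.2 hh),
        one_smul] at hω
      rw [hω]
  have hYm : AEMeasurable (fun ω i => W (a i) ω) P := (hW.hasGaussianLaw a).aemeasurable
  have hRm : Measurable R := (Lp.stronglyMeasurable R).measurable
  have hRi : Integrable R P := (Lp.memLp R).integrable one_le_two
  set m₁ := P.withDensity fun ω => ENNReal.ofReal (R ω) with hm₁
  set m₂ := P.withDensity fun ω => ENNReal.ofReal (-R ω) with hm₂
  have : IsFiniteMeasure m₁ := isFiniteMeasure_withDensity_of_integrable hRi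
  have : IsFiniteMeasure m₂ := isFiniteMeasure_withDensity_of_integrable hRi.neg
  have hY₁ : AEMeasurable (fun ω i => W (a i) ω) m₁ :=
    hYm.mono_ac (withDensity_absolutelyContinuous _ _)
  have hY₂ : AEMeasurable (fun ω i => W (a i) ω) m₂ :=
    hYm.mono_ac (withDensity_absolutelyContinuous _ _)
  -- The images of R⁺P and R⁻P under (W(a_i)) have characteristic functions differing by E[R exp(i
  -- W(Σ L_i a_i))], which is 0 by `hexp`.
  have heq : m₁.map (fun ω i => W (a i) ω) = m₂.map (fun ω i => W (a i) ω) := by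
    refine Measure.ext_of_charFunDual (funext fun L => sub_eq_zero.1 ?_)
    have hc : Continuous fun x : Fin n → ℝ => Complex.exp ((L x : ℂ) * Complex.I) := by fun_prop
    rw [charFunDual_apply, charFunDual_apply, integral_map hY₁ hc.aestronglyMeasurable,
      integral_map hY₂ hc.aestronglyMeasurable, integral_withDensity_sub hRm
        (hc.comp_aestronglyMeasurable hYm.aestronglyMeasurable)]
    · rw [← hexp (∑ i, L (Pi.single i 1) • a i)]
      refine integral_congr_ae ?_
      filter_upwards [hW.ae_eq_sum a fun i => L (Pi.single i 1)] with ω hω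
      rw [hω]
      have : L (fun i => W (a i) ω) = ∑ i, L (Pi.single i 1) * W (a i) ω := by
        conv_lhs => rw [← Finset.univ_sum_single fun i => W (a i) ω, map_sum]
        refine Finset.sum_congr rfl fun i _ => ?_
        have : (Pi.single i (W (a i) ω) : Fin n → ℝ) = W (a i) ω • Pi.single i 1 := by
          rw [← Pi.single_smul, smul_eq_mul, mul_one]
        rw [this, map_smul, smul_eq_mul, mul_comm]
      rw [this]
    · refine hRi.mono (hRm.aestronglyMeasurable.smul
        (hc.comp_aestronglyMeasurable hYm.aestronglyMeasurable)) (ae_of_all _ fun ω => ?_)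
      rw [norm_smul, Complex.norm_exp_ofReal_mul_I, mul_one]
  have hfc := hf.continuous
  have hfin := congrArg (fun m => ∫ x, f x ∂m) heq
  beta_reduce at hfin
  rw [integral_map hY₁ hfc.aestronglyMeasurable, integral_map hY₂ hfc.aestronglyMeasurable,
    ← sub_eq_zero, integral_withDensity_sub hRm
      (hfc.comp_aestronglyMeasurable hYm.aestronglyMeasurable)
      ((Lp.memLp R).integrable_mul (hW.memLp_comp a hf (p := 2) ENNReal.ofNat_ne_top))] at hfin
  exact hfin

/-- The pseudo-inverse of the Ornstein-Uhlenbeck generator is in the domain of the derivative,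
and `⟪D G, -D L⁻¹ F⟫ = ⟪G, F⟫`. -/
theorem exists_deriv_pseudoInvL [CompleteSpace H] (hW : IsIsonormal W P) (F : Lp ℝ 2 P)
    (hF : ∫ ω, F ω ∂P = 0) :
    ∃ U, (-pseudoInvL W P F, U) ∈ malliavinGraph W P ∧
      ∀ p ∈ malliavinGraph W P, inner ℝ p.2 U = (inner ℝ p.1 F : ℝ) := by
  have hS : ∀ q : ℕ, ∀ V ∈ wienerChaos W P (q + 1),
      ∃ U, (V, U) ∈ eigenGraph (malliavinSubmodule W P) ((q : ℝ) + 1) := by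
    intro q V hV
    have := hW.exists_eigenGraph_of_wienerChaos (q + 1) hV
    rwa [Nat.cast_succ] at this
  obtain ⟨hsum, U, hU, hUp⟩ := exists_pseudoInverse (isClosed_malliavinSubmodule W P)
    (fun q => wienerChaos W P (q + 1)) hS F
  refine ⟨U, ?_, fun p hp => ?_⟩
  · rw [pseudoInvL, neg_neg]
    exact mem_malliavinSubmodule.1 hU
  rw [hUp p (mem_malliavinSubmodule.2 hp), ← sub_eq_zero, ← inner_sub_right]
  set x : ℕ → Lp ℝ 2 P := fun q => (wienerChaos W P (q + 1)).starProjection F with hx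
  have hmem : ∀ q, x q ∈ wienerChaos W P (q + 1) := fun q =>
    Submodule.starProjection_apply_mem _ _
  -- The abstract result represents the sum of the projections of `F` onto the chaoses of order at
  -- least 1, not `F`; it remains to see that the defect `R` is invisible to the domain of D.
  set R : Lp ℝ 2 P := (∑' q, x q) - F with hRdef
  have hinner : ∀ V : Lp ℝ 2 P, HasSum (fun q => inner ℝ V (x q)) (inner ℝ V (∑' q, x q) : ℝ) :=
    fun V => (innerSL ℝ V).hasSum hsum.hasSum
  have hchaos : ∀ q, ∀ V ∈ wienerChaos W P (q + 1), inner ℝ V R = (0 : ℝ) := by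
    intro q V hV
    have h1 : HasSum (fun r => inner ℝ V (x r)) (inner ℝ V (x q) : ℝ) := by
      refine hasSum_single q fun r hr => ?_
      obtain ⟨u, hu⟩ := hS q V hV
      obtain ⟨v, hv⟩ := hS r _ (hmem r)
      refine inner_eq_zero_of_eigenGraph (fun h => hr ?_) hu hv
      have := add_right_cancel h
      exact_mod_cast this.symm
    have h2 := Submodule.starProjection_inner_eq_zero (K := wienerChaos W P (q + 1)) F V hV
    rw [hRdef, inner_sub_right, (hinner V).unique h1, ← inner_sub_right, ← neg_sub F,
      inner_neg_right, real_inner_comm, neg_eq_zero]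
    exact h2
  have hone : MemLp (fun _ : Ω => (1 : ℝ)) 2 P := memLp_const 1
  have hF0 : inner ℝ (hone.toLp _) F = (0 : ℝ) := by
    rw [L2.inner_def, ← hF]
    refine integral_congr_ae ?_
    filter_upwards [hone.coeFn_toLp] with ω hω
    rw [hω, RCLike.inner_apply, conj_trivial, mul_one]
  -- Constants have derivative 0, so they are eigenvectors for 0 and orthogonal to the higher
  -- chaoses; they are orthogonal to `F` because `F` is centered.
  have hconst : inner ℝ (hone.toLp _) R = (0 : ℝ) := by
    have h1 : (hone.toLp _, (0 : Lp H 2 P)) ∈ eigenGraph (malliavinSubmodule W P) 0 := by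
      refine ⟨mem_malliavinSubmodule.2 (subset_closure
        ⟨0, Fin.elim0, fun _ => 1, .const 1, hone.coeFn_toLp, ?_⟩), fun q _ => by simp⟩
      filter_upwards [Lp.coeFn_zero H 2 P] with ω hω
      simp
    have h2 : HasSum (fun r => inner ℝ (hone.toLp _) (x r)) (0 : ℝ) := by
      convert hasSum_zero with r
      obtain ⟨v, hv⟩ := hS r _ (hmem r)
      exact inner_eq_zero_of_eigenGraph (by positivity) h1 hv
    rw [hRdef, inner_sub_right, (hinner _).unique h2, hF0, sub_zero]
  have hR0 : ∫ ω, R ω ∂P = 0 := by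
    rw [← hconst, L2.inner_def]
    refine integral_congr_ae ?_
    filter_upwards [hone.coeFn_toLp] with ω hω
    rw [hω, RCLike.inner_apply, conj_trivial, mul_one]
  have hRH : ∀ h : H, ‖h‖ = 1 → ∀ q, ∫ ω, R ω * (hermiteR q).eval (W h ω) ∂P = 0 := by
    intro h hh q
    cases q with
    | zero => simpa [hermiteR] using hR0
    | succ q =>
      have hm := hW.memLp_eval h (hermiteR (q + 1))
      rw [← hchaos q (hm.toLp _) (Submodule.le_topologicalClosure _ (Submodule.subset_span
        ⟨h, hh, hm.coeFn_toLp.trans (ae_of_all _ fun ω => eval_hermiteR _ _)⟩)), L2.inner_def]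
      refine integral_congr_ae ?_
      filter_upwards [hm.coeFn_toLp] with ω hω
      rw [hω, RCLike.inner_apply, conj_trivial]
  -- Only limits of smooth variables are tested, so `R` need not be 0: W is not assumed to generate
  -- the σ-algebra.
  refine malliavinGraph_induction (C := {p | inner ℝ p.1 R = (0 : ℝ)})
    (isClosed_eq (by fun_prop) (by fun_prop)) ?_ hp
  rintro p ⟨n, a, f, hf, h1, -⟩
  rw [Set.mem_ofPred_eq, L2.inner_def, ← hW.integral_mul_smooth_eq_zero hR0 hRH a hf]
  refine integral_congr_ae ?_
  filter_upwards [h1] with ω hω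
  rw [hω, RCLike.inner_apply, conj_trivial]

end IsIsonormal

end Total

/-! ### The chain rule and integration by parts for h(F) -/

section ChainRule

open scoped NNReal

variable {Ω H : Type*} [MeasurableSpace Ω] [NormedAddCommGroup H] [InnerProductSpace ℝ H]
  {P : Measure Ω} {W : H → Ω → ℝ} {h h' : ℝ → ℝ} {C : ℝ≥0}

lemma memLp_comp_smul (hc : Continuous h') (hC : ∀ x, ‖h' x‖ ≤ C) (F : Lp ℝ 2 P) (U : Lp H 2 P) :
    MemLp (fun ω => h' (F ω) • U ω) 2 P :=
  (Lp.memLp U).of_le_mul (c := C)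
    ((hc.comp_aestronglyMeasurable (Lp.aestronglyMeasurable F)).smul (Lp.aestronglyMeasurable U))
    (ae_of_all _ fun ω => by
      rw [norm_smul]; exact mul_le_mul_of_nonneg_right (hC _) (norm_nonneg _))

/-- The chain rule for smooth random variables. -/
lemma smoothGraph_comp (hh : h.HasTemperateGrowth) (hd : ∀ x, HasDerivAt h (h' x) x)
    (hc : Continuous h') (hC : ∀ x, ‖h' x‖ ≤ C) (hL : LipschitzWith C h) (h0 : h 0 = 0)
    {p : Lp ℝ 2 P × Lp H 2 P} (hp : p ∈ smoothGraph W P) :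
    (hL.compLp h0 p.1, (memLp_comp_smul hc hC p.1 p.2).toLp) ∈ smoothGraph W P := by
  obtain ⟨n, a, f, hf, h1, h2⟩ := hp
  refine ⟨n, a, fun x => h (f x), hh.comp hf, ?_, ?_⟩
  · filter_upwards [hL.coeFn_compLp h0 p.1, h1] with ω e1 e2
    rw [e1, Function.comp_apply, e2]
  · filter_upwards [(memLp_comp_smul hc hC p.1 p.2).coeFn_toLp, h1, h2] with ω e1 e2 e3
    rw [e1, e2, e3, Finset.smul_sum]
    refine Finset.sum_congr rfl fun i _ => ?_
    have := (hd _).comp_hasFDerivAt (fun j => W (a j) ω)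
      (hf.differentiable fun j => W (a j) ω).hasFDerivAt
    rw [show (fun x => h (f x)) = h ∘ f from rfl, this.fderiv, _root_.smul_apply, smul_smul,
      smul_eq_mul]

/-- Integration by parts for `h(F)`, `F` in the domain of the derivative and `h` smooth with
bounded derivative. -/
lemma integral_deriv_mul_inner (hh : h.HasTemperateGrowth) (hd : ∀ x, HasDerivAt h (h' x) x)
    (hc : Continuous h') (hC : ∀ x, ‖h' x‖ ≤ C) (h0 : h 0 = 0)
    {F E : Lp ℝ 2 P} {D U : Lp H 2 P} (hFD : (F, D) ∈ malliavinGraph W P)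
    (hU : ∀ p ∈ malliavinGraph W P, inner ℝ p.2 U = (inner ℝ p.1 E : ℝ)) :
    ∫ ω, h' (F ω) * inner ℝ (D ω) (U ω) ∂P = ∫ ω, h (F ω) * E ω ∂P := by
  have hL : LipschitzWith C h := lipschitzWith_of_nnnorm_deriv_le
    (fun x => (hd x).differentiableAt) fun x => by rw [(hd x).deriv]; exact hC x
  obtain ⟨p, hp, hlim⟩ := mem_closure_iff_seq_limit.1 hFD
  have hlim1 : Tendsto (fun n => (p n).1) atTop (𝓝 F) := (continuous_fst.tendsto _).comp hlim
  -- A subsequence converging almost surely is needed, because h'(F_n) is controlled only pointwise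
  -- and by its bound.
  obtain ⟨ns, hns, hae⟩ := (tendstoInMeasure_of_tendsto_Lp hlim1).exists_seq_tendsto_ae
  have hlim' := hlim.comp hns.tendsto_atTop
  have hlim1' : Tendsto (fun n => (p (ns n)).1) atTop (𝓝 F) :=
    (continuous_fst.tendsto _).comp hlim'
  have hlim2' : Tendsto (fun n => (p (ns n)).2) atTop (𝓝 D) :=
    (continuous_snd.tendsto _).comp hlim'
  have hV : ∀ (G : Lp ℝ 2 P) (A : Lp H 2 P),
      inner ℝ A (memLp_comp_smul hc hC G U).toLp = ∫ ω, h' (G ω) * inner ℝ (A ω) (U ω) ∂P := by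
    intro G A
    rw [L2.inner_def]
    refine integral_congr_ae ?_
    filter_upwards [(memLp_comp_smul hc hC G U).coeFn_toLp] with ω e
    rw [e, real_inner_smul_right]
  have hR : ∀ G : Lp ℝ 2 P, inner ℝ (hL.compLp h0 G) E = ∫ ω, h (G ω) * E ω ∂P := by
    intro G
    rw [L2.inner_def]
    refine integral_congr_ae ?_
    filter_upwards [hL.coeFn_compLp h0 G] with ω e
    rw [e, RCLike.inner_apply, conj_trivial, mul_comm]; rfl
  have hsmooth : ∀ n, inner ℝ (p (ns n)).2 (memLp_comp_smul hc hC (p (ns n)).1 U).toLp =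
      (inner ℝ (hL.compLp h0 (p (ns n)).1) E : ℝ) := by
    intro n
    rw [← hU _ (subset_closure (smoothGraph_comp hh hd hc hC hL h0 (hp (ns n)))), L2.inner_def,
      L2.inner_def]
    refine integral_congr_ae ?_
    filter_upwards [(memLp_comp_smul hc hC (p (ns n)).1 U).coeFn_toLp,
      (memLp_comp_smul hc hC (p (ns n)).1 (p (ns n)).2).coeFn_toLp] with ω e1 e2
    rw [e1, e2, real_inner_smul_right, real_inner_smul_left]
  have l1 : Tendsto (fun n => (inner ℝ (hL.compLp h0 (p (ns n)).1) E : ℝ)) atTop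
      (𝓝 (inner ℝ (hL.compLp h0 F) E)) :=
    (((hL.continuous_compLp h0).tendsto F).comp hlim1').inner tendsto_const_nhds
  -- Along the approximation, ⟪D_n, h'(F_n) U⟫ splits into the term with D_n - D, which tends to 0
  -- since h' is bounded, and the term with D, handled by dominated convergence.
  have l2 : Tendsto (fun n => inner ℝ ((p (ns n)).2 - D)
      (memLp_comp_smul hc hC (p (ns n)).1 U).toLp) atTop (𝓝 0) := by
    have l3 : Tendsto (fun n => ‖(p (ns n)).2 - D‖ * (C * ‖U‖)) atTop (𝓝 0) := by
      have := (tendsto_iff_norm_sub_tendsto_zero.1 hlim2').mul_const (C * ‖U‖)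
      rwa [zero_mul] at this
    refine squeeze_zero_norm (fun n => (norm_inner_le_norm _ _).trans
      (mul_le_mul_of_nonneg_left ?_ (norm_nonneg _))) l3
    refine Lp.norm_le_mul_norm_of_ae_le_mul ?_
    filter_upwards [(memLp_comp_smul hc hC (p (ns n)).1 U).coeFn_toLp] with ω e
    rw [e, norm_smul]
    exact mul_le_mul_of_nonneg_right (hC _) (norm_nonneg _)
  have l4 : Tendsto (fun n => ∫ ω, h' ((p (ns n)).1 ω) * inner ℝ (D ω) (U ω) ∂P) atTop
      (𝓝 (∫ ω, h' (F ω) * inner ℝ (D ω) (U ω) ∂P)) := by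
    have hi : Integrable (fun ω => (inner ℝ (D ω) (U ω) : ℝ)) P := L2.integrable_inner D U
    refine tendsto_integral_of_dominated_convergence
      (fun ω => C * ‖(inner ℝ (D ω) (U ω) : ℝ)‖) (fun n => ?_) (hi.norm.const_mul _)
      (fun n => ae_of_all _ fun ω => ?_) ?_
    · exact (hc.comp_aestronglyMeasurable (Lp.aestronglyMeasurable _)).mul hi.1
    · rw [norm_mul]
      exact mul_le_mul_of_nonneg_right (hC _) (norm_nonneg _)
    · filter_upwards [hae] with ω hω
      exact ((hc.tendsto _).comp hω).mul_const _
  rw [← hR]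
  refine tendsto_nhds_unique ?_ l1
  have := l2.add l4
  rw [zero_add] at this
  refine this.congr fun n => ?_
  rw [← hV, ← inner_add_left, sub_add_cancel, hsmooth]

end ChainRule

/-! ### Trigonometric test functions -/

section Trigonometric

lemma Real.hasTemperateGrowth_sin : Real.sin.HasTemperateGrowth :=
  ⟨Real.contDiff_sin, fun n => ⟨0, 1, fun x => by
    rw [norm_iteratedFDeriv_eq_norm_iteratedDeriv, pow_zero, mul_one]
    exact Real.abs_iteratedDeriv_sin_le_one n x⟩⟩

lemma Real.hasTemperateGrowth_cos : Real.cos.HasTemperateGrowth :=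
  ⟨Real.contDiff_cos, fun n => ⟨0, 1, fun x => by
    rw [norm_iteratedFDeriv_eq_norm_iteratedDeriv, pow_zero, mul_one]
    exact Real.abs_iteratedDeriv_cos_le_one n x⟩⟩

lemma hasTemperateGrowth_const_mul_id (t : ℝ) : (fun x : ℝ => t * x).HasTemperateGrowth :=
  (t • ContinuousLinearMap.id ℝ ℝ).hasTemperateGrowth

lemma exists_antideriv_cos (t : ℝ) : ∃ h : ℝ → ℝ, h.HasTemperateGrowth ∧ h 0 = 0 ∧
    ∀ x, HasDerivAt h (Real.cos (t * x)) x := by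
  rcases eq_or_ne t 0 with rfl | ht
  · exact ⟨fun x => x, (ContinuousLinearMap.id ℝ ℝ).hasTemperateGrowth, rfl,
      fun x => by simpa using hasDerivAt_id' x⟩
  · refine ⟨fun x => t⁻¹ * Real.sin (t * x), (Function.HasTemperateGrowth.const _).mul
      (Real.hasTemperateGrowth_sin.comp (hasTemperateGrowth_const_mul_id t)), by simp, fun x => ?_⟩
    have := (((hasDerivAt_id' x).const_mul t).sin).const_mul t⁻¹
    exact this.congr_deriv (by field_simp)

lemma exists_antideriv_sin (t : ℝ) : ∃ h : ℝ → ℝ, h.HasTemperateGrowth ∧ h 0 = 0 ∧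
    ∀ x, HasDerivAt h (Real.sin (t * x)) x := by
  rcases eq_or_ne t 0 with rfl | ht
  · exact ⟨fun x => 0, .const 0, rfl, fun x => by simpa using hasDerivAt_const x (0 : ℝ)⟩
  · refine ⟨fun x => t⁻¹ * (1 + -1 * Real.cos (t * x)), (Function.HasTemperateGrowth.const _).mul
      ((Function.HasTemperateGrowth.const _).add ((Function.HasTemperateGrowth.const _).mul
      (Real.hasTemperateGrowth_cos.comp (hasTemperateGrowth_const_mul_id t)))), by simp,
      fun x => ?_⟩
    have := (((((hasDerivAt_id' x).const_mul t).cos).const_mul (-1)).const_add 1).const_mul t⁻¹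
    exact this.congr_deriv (by field_simp)

end Trigonometric

/-! ### From Stein's identity to a Stein kernel -/

section Identification

lemma isAntideriv_of_hasDerivAt {g h : ℝ → ℝ} (hc : Continuous g)
    (hd : ∀ x, HasDerivAt h (g x) x) : IsAntideriv h g := fun a b =>
  ⟨hc.intervalIntegrable a b,
    intervalIntegral.integral_eq_sub_of_hasDerivAt (fun x _ => hd x) (hc.intervalIntegrable a b)⟩

variable {μ : Measure ℝ} [IsFiniteMeasure μ]

lemma isFiniteMeasure_withDensity_steinMass (h2 : Integrable (fun x => x ^ 2) μ) :
    IsFiniteMeasure (volume.withDensity (steinMass μ)) := by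
  refine isFiniteMeasure_withDensity ?_
  rw [lintegral_steinMass]
  have := h2.2
  rw [HasFiniteIntegral] at this
  simp only [enorm_pow] at this
  exact this.ne

lemma integral_withDensity_steinMass_of_nonneg {g h : ℝ → ℝ} (hc : Continuous g)
    (hg : ∀ x, 0 ≤ g x) (hd : ∀ x, HasDerivAt h (g x) x) (h0 : h 0 = 0) :
    ∫ y, g y ∂(volume.withDensity (steinMass μ)) = ∫ x, x * h x ∂μ := by
  have hh : Continuous h := continuous_iff_continuousAt.2 fun x => (hd x).continuousAt
  obtain ⟨h1, h3⟩ := lintegral_mul_steinMass_antideriv μ hc.measurable hg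
    (isAntideriv_of_hasDerivAt hc hd)
  simp only [h0, sub_zero] at h1 h3
  rw [integral_eq_lintegral_of_nonneg_ae (ae_of_all _ hg) hc.aestronglyMeasurable,
    integral_eq_lintegral_of_nonneg_ae (ae_of_all _ h3)
      (continuous_id.mul hh).aestronglyMeasurable, ← h1,
    lintegral_withDensity_eq_lintegral_mul _ (measurable_steinMass μ) hc.measurable.ennreal_ofReal]
  simp only [Pi.mul_apply, mul_comm]

lemma integral_withDensity_steinMass (h2 : Integrable (fun x => x ^ 2) μ) {g h : ℝ → ℝ}
    (hc : Continuous g) (hg : ∀ x, |g x| ≤ 1) (hd : ∀ x, HasDerivAt h (g x) x) (h0 : h 0 = 0) :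
    ∫ y, g y ∂(volume.withDensity (steinMass μ)) = ∫ x, x * h x ∂μ := by
  have := isFiniteMeasure_withDensity_steinMass h2
  have hh : Continuous h := continuous_iff_continuousAt.2 fun x => (hd x).continuousAt
  -- Since |g| ≤ 1, the nonnegative case applies to g + 1 and to 1; the difference is legitimate
  -- because m dy is finite.
  have e1 := integral_withDensity_steinMass_of_nonneg (μ := μ) (hc.add (continuous_const (y := 1)))
    (fun x => show 0 ≤ g x + 1 by linarith [(abs_le.1 (hg x)).1])
    (fun x => (hd x).add (hasDerivAt_id' x))
    (by simp [h0])
  have e2 := integral_withDensity_steinMass_of_nonneg (μ := μ) (continuous_const (y := (1 : ℝ)))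
    (fun x => zero_le_one) (fun x => hasDerivAt_id' x) rfl
  have hL : LipschitzWith 1 h := lipschitzWith_of_nnnorm_deriv_le
    (fun x => (hd x).differentiableAt) fun x => by rw [(hd x).deriv]; exact hg x
  have i1 : Integrable (fun x => x * h x) μ := by
    refine h2.mono (continuous_id.mul hh).aestronglyMeasurable (ae_of_all _ fun x => ?_)
    rw [norm_mul, norm_pow, sq]
    refine mul_le_mul_of_nonneg_left ?_ (norm_nonneg _)
    have := hL.dist_le_mul x 0
    simpa [h0, dist_zero_right] using this
  have i2 : Integrable (fun x : ℝ => x * x) μ := by simpa only [sq] using h2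
  have i3 : Integrable g (volume.withDensity (steinMass μ)) :=
    (integrable_const (1 : ℝ)).mono hc.aestronglyMeasurable
      (ae_of_all _ fun x => by simpa using hg x)
  simp only [Pi.add_apply, mul_add] at e1
  rw [integral_add i3 (integrable_const _), integral_add i1 i2, e2] at e1
  exact add_right_cancel e1

lemma Measure.ext_of_integral_cos_sin {m n : Measure ℝ} [IsFiniteMeasure m] [IsFiniteMeasure n]
    (hcos : ∀ t : ℝ, ∫ x, Real.cos (t * x) ∂m = ∫ x, Real.cos (t * x) ∂n)
    (hsin : ∀ t : ℝ, ∫ x, Real.sin (t * x) ∂m = ∫ x, Real.sin (t * x) ∂n) : m = n := by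
  have key : ∀ k : Measure ℝ, IsFiniteMeasure k → ∀ t : ℝ, charFun k t =
      ((∫ x, Real.cos (t * x) ∂k : ℝ) : ℂ) + ((∫ x, Real.sin (t * x) ∂k : ℝ) : ℂ) * Complex.I := by
    intro k _ t
    have hi : ∀ f : ℝ → ℝ, Continuous f → (∀ x, |f x| ≤ 1) → Integrable f k := fun f hf hb =>
      (integrable_const (1 : ℝ)).mono hf.aestronglyMeasurable
        (ae_of_all _ fun x => by simpa using hb x)
    rw [charFun_apply_real, ← integral_complex_ofReal, ← integral_complex_ofReal,
      ← integral_mul_const, ← integral_add]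
    · refine integral_congr_ae (ae_of_all _ fun x => ?_)
      simp only
      rw [Complex.exp_mul_I]
      push_cast
      rfl
    · exact (hi _ (by fun_prop) fun x => Real.abs_cos_le_one _).ofReal
    · exact (hi _ (by fun_prop) fun x => Real.abs_sin_le_one _).ofReal.mul_const _
  refine Measure.ext_of_charFun (funext fun t => ?_)
  rw [key m inferInstance, key n inferInstance, hcos, hsin]

/-- A function satisfying Stein's identity for the trigonometric test functions is a.e. equal to
a Stein kernel. -/
theorem exists_isSteinKernel_of_integral (h2 : Integrable (fun x => x ^ 2) μ) {r : ℝ → ℝ}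
    (hr : Measurable r) (hi : Integrable r μ)
    (hcos : ∀ (t : ℝ) (h : ℝ → ℝ), h.HasTemperateGrowth → h 0 = 0 →
      (∀ x, HasDerivAt h (Real.cos (t * x)) x) →
      ∫ x, Real.cos (t * x) * r x ∂μ = ∫ x, x * h x ∂μ)
    (hsin : ∀ (t : ℝ) (h : ℝ → ℝ), h.HasTemperateGrowth → h 0 = 0 →
      (∀ x, HasDerivAt h (Real.sin (t * x)) x) →
      ∫ x, Real.sin (t * x) * r x ∂μ = ∫ x, x * h x ∂μ) :
    ∃ γ, IsSteinKernel μ γ ∧ r =ᵐ[μ] γ := by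
  have := isFiniteMeasure_withDensity_steinMass h2
  have : IsFiniteMeasure (μ.withDensity fun x => ENNReal.ofReal (r x)) :=
    isFiniteMeasure_withDensity_of_integrable hi
  have : IsFiniteMeasure (μ.withDensity fun x => ENNReal.ofReal (-r x)) :=
    isFiniteMeasure_withDensity_of_integrable hi.neg
  have hstep : ∀ g : ℝ → ℝ, Continuous g → (∀ x, |g x| ≤ 1) →
      (∫ x, g x * r x ∂μ = ∫ y, g y ∂(volume.withDensity (steinMass μ))) →
      ∫ x, g x ∂(μ.withDensity fun x => ENNReal.ofReal (r x)) =
        ∫ x, g x ∂((μ.withDensity fun x => ENNReal.ofReal (-r x)) +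
          volume.withDensity (steinMass μ)) := by
    intro g hc hg he
    have hgi : ∀ k : Measure ℝ, IsFiniteMeasure k → Integrable g k := fun k _ =>
      (integrable_const (1 : ℝ)).mono hc.aestronglyMeasurable
        (ae_of_all _ fun x => by simpa using hg x)
    have e := integral_withDensity_sub (P := μ) hr hc.aestronglyMeasurable
      (hi.mono (hr.aestronglyMeasurable.smul hc.aestronglyMeasurable) (ae_of_all _ fun x => by
        rw [norm_smul]
        exact mul_le_of_le_one_right (norm_nonneg _) (hg x)))
    rw [integral_add_measure (hgi _ inferInstance) (hgi _ inferInstance), ← he,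
      eq_add_of_sub_eq' e]
    simp only [smul_eq_mul, mul_comm]
  -- This is r·μ = m dy, with the negative part of r moved to the right so that both sides are
  -- finite positive measures determined by cosine and sine integrals.
  have heq : (μ.withDensity fun x => ENNReal.ofReal (r x)) =
      (μ.withDensity fun x => ENNReal.ofReal (-r x)) + volume.withDensity (steinMass μ) := by
    refine Measure.ext_of_integral_cos_sin (fun t => ?_) fun t => ?_
    · obtain ⟨h, hh, h0, hd⟩ := exists_antideriv_cos t
      have hc : Continuous fun x => Real.cos (t * x) := by fun_prop
      refine hstep _ hc (fun x => Real.abs_cos_le_one _) ?_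
      rw [hcos t h hh h0 hd, integral_withDensity_steinMass h2 hc
        (fun x => Real.abs_cos_le_one _) hd h0]
    · obtain ⟨h, hh, h0, hd⟩ := exists_antideriv_sin t
      have hc : Continuous fun x => Real.sin (t * x) := by fun_prop
      refine hstep _ hc (fun x => Real.abs_sin_le_one _) ?_
      rw [hsin t h hh h0 hd, integral_withDensity_steinMass h2 hc
        (fun x => Real.abs_sin_le_one _) hd h0]
  have hn : Measurable fun x => ENNReal.ofReal (-r x) := hr.neg.ennreal_ofReal
  have hN : MeasurableSet {x | r x < 0} := measurableSet_lt hr measurable_const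
  -- On {r < 0} the left side of `heq` has no mass, hence neither has the negative part on the
  -- right; so r ≥ 0 almost everywhere.
  have h3 : (μ.withDensity fun x => ENNReal.ofReal (-r x)) {x | r x < 0} = 0 := by
    have h4 : (μ.withDensity fun x => ENNReal.ofReal (r x)) {x | r x < 0} = 0 := by
      rw [withDensity_apply _ hN, setLIntegral_eq_zero_iff hN hr.ennreal_ofReal]
      exact ae_of_all _ fun x hx => ENNReal.ofReal_eq_zero.2 (le_of_lt hx)
    rw [heq, Measure.add_apply] at h4
    exact (add_eq_zero.1 h4).1
  have h5 : ∀ᵐ x ∂μ, 0 ≤ r x := by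
    rw [withDensity_apply _ hN, setLIntegral_eq_zero_iff hN hn] at h3
    filter_upwards [h3] with x hx
    by_contra h
    have := ENNReal.ofReal_eq_zero.1 (hx (not_le.1 h))
    linarith [not_le.1 h]
  have h6 : (μ.withDensity fun x => ENNReal.ofReal (-r x)) = 0 := by
    rw [withDensity_eq_zero_iff hn.aemeasurable]
    filter_upwards [h5] with x hx
    exact ENNReal.ofReal_eq_zero.2 (by linarith)
  refine ⟨fun x => max (r x) 0, ⟨hr.max measurable_const, fun x => le_max_right _ _, ?_⟩, ?_⟩
  · rw [h6, zero_add] at heq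
    rw [← heq]
    refine withDensity_congr_ae ?_
    filter_upwards [h5] with x hx
    rw [max_eq_left hx]
  · filter_upwards [h5] with x hx
    rw [max_eq_left hx]

end Identification

/-! ### The Malliavin Stein kernel and the theorem -/

/-- The law of a centered `F` in the domain of the Malliavin derivative has a Stein kernel, given
by `g_F`. -/
theorem exists_isSteinKernel {Ω H : Type*} [MeasurableSpace Ω] {P : Measure Ω}
    [IsProbabilityMeasure P] [NormedAddCommGroup H] [InnerProductSpace ℝ H] [CompleteSpace H]
    {W : H → Ω → ℝ} (hW : IsIsonormal W P) {F : Lp ℝ 2 P} (hF : F ∈ malliavinDomain W P)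
    (hF0 : ∫ ω, F ω ∂P = 0) :
    ∃ γ, IsSteinKernel (P.map F) γ ∧ gRV W P F =ᵐ[P] γ ∘ F := by
  obtain ⟨D, hD⟩ := hF
  obtain ⟨U, hU, hUp⟩ := hW.exists_deriv_pseudoInvL F hF0
  have hU' : (pseudoInvL W P F, -U) ∈ malliavinGraph W P := by
    have := (malliavinSubmodule W P).neg_mem (mem_malliavinSubmodule.2 hU)
    rw [Prod.neg_mk, neg_neg] at this
    exact mem_malliavinSubmodule.1 this
  have hFm : Measurable F := (Lp.stronglyMeasurable F).measurable
  have hle : MeasurableSpace.comap F inferInstance ≤ ‹MeasurableSpace Ω› := hFm.comap_le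
  have hΘ : Integrable (fun ω => (inner ℝ (D ω) (U ω) : ℝ)) P := L2.integrable_inner D U
  have hg : gRV W P F =ᵐ[P] P[fun ω => (inner ℝ (D ω) (U ω) : ℝ) |
      MeasurableSpace.comap F inferInstance] := by
    rw [gRV, hW.malliavinDeriv_eq hD, hW.malliavinDeriv_eq hU']
    refine condExp_congr_ae ?_
    filter_upwards [Lp.coeFn_neg U] with ω hω
    rw [hω, Pi.neg_apply, neg_neg]
  -- A conditional expectation given F is a measurable function of F; this `r` is the candidate
  -- kernel on the line.
  obtain ⟨r, hr, hgr⟩ := StronglyMeasurable.exists_eq_measurable_comp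
    (stronglyMeasurable_condExp (μ := P) (m := MeasurableSpace.comap F inferInstance)
      (f := fun ω => (inner ℝ (D ω) (U ω) : ℝ)))
  have hri : Integrable r (P.map F) := by
    rw [integrable_map_measure hr.aestronglyMeasurable hFm.aemeasurable, ← hgr]
    exact integrable_condExp
  have h2 : Integrable (fun x : ℝ => x ^ 2) (P.map F) :=
    (integrable_map_measure (by fun_prop) hFm.aemeasurable).2 (Lp.memLp F).integrable_sq
  have : IsProbabilityMeasure (P.map F) := Measure.isProbabilityMeasure_map hFm.aemeasurable
  have hstep : ∀ g h : ℝ → ℝ, Continuous g → (∀ x, |g x| ≤ 1) → h.HasTemperateGrowth → h 0 = 0 →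
      (∀ x, HasDerivAt h (g x) x) → ∫ x, g x * r x ∂(P.map F) = ∫ x, x * h x ∂(P.map F) := by
    intro g h hc hb hh h0 hd
    have m1 : Measurable fun x => g x * r x := hc.measurable.mul hr.measurable
    have m2 : Measurable fun x => x * h x := measurable_id.mul hh.continuous.measurable
    rw [integral_map hFm.aemeasurable m1.aestronglyMeasurable,
      integral_map hFm.aemeasurable m2.aestronglyMeasurable]
    -- The bounded F-measurable factor g(F) passes through the conditional expectation, so r(F) may
    -- replace the inner product of the derivatives.
    have e1 := condExp_stronglyMeasurable_mul_of_bound (μ := P) hle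
      (hc.measurable.comp (comap_measurable F)).stronglyMeasurable hΘ 1
      (ae_of_all _ fun ω => hb (F ω))
    have e2 := integral_deriv_mul_inner hh hd hc (C := 1) hb h0 hD hUp
    rw [hgr] at e1
    have e3 : ∫ ω, g (F ω) * r (F ω) ∂P = ∫ ω, g (F ω) * inner ℝ (D ω) (U ω) ∂P :=
      (integral_congr_ae e1).symm.trans (integral_condExp hle)
    rw [e3, e2]
    simp only [mul_comm]
  obtain ⟨γ, hγ, hrγ⟩ := exists_isSteinKernel_of_integral h2 hr.measurable hri
    (fun t h hh h0 hd => hstep _ h (by fun_prop) (fun x => Real.abs_cos_le_one _) hh h0 hd)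
    (fun t h hh h0 hd => hstep _ h (by fun_prop) (fun x => Real.abs_sin_le_one _) hh h0 hd)
  refine ⟨γ, hγ, hg.trans ?_⟩
  rw [hgr]
  exact ae_of_ae_map hFm.aemeasurable hrγ

theorem mainTheorem5 {Ω H : Type*} [MeasurableSpace Ω] (P : Measure Ω) [IsProbabilityMeasure P]
    [NormedAddCommGroup H] [InnerProductSpace ℝ H] [CompleteSpace H]
    [TopologicalSpace.SeparableSpace H]
    (W : H → Ω → ℝ) (hW : IsIsonormal W P)
    (X Z : Lp ℝ 2 P) (hX : X ∈ malliavinDomain W P) (hZ : Z ∈ malliavinDomain W P)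
    (hX0 : ∫ ω, X ω ∂P = 0) (hZ0 : ∫ ω, Z ω ∂P = 0)
    (l u : EReal) (ρ : ℝ → ℝ) (hlaw : IsTargetLaw (P.map Z) l u ρ)
    (hX1 : (∃ M : ℝ, ∀ x, |gStar ρ l u x| ≤ M) ∨ P.map X ≪ volume)
    (hg : EndpointCondition (gStar ρ l u) l u)
    (hfin : Integrable (fun ω => gStar ρ l u (Z ω) ^ 2) P)
    (G : ℝ → ℝ) (hG : IsAntideriv G (gStar ρ l u)) :
    P.map X = P.map Z ↔
      (Integrable (fun ω => gStar ρ l u (X ω) ^ 2) P ∧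
        ∫ ω, gStar ρ l u (X ω) ^ 2 ∂P = ∫ ω, gStar ρ l u (Z ω) ^ 2 ∂P) ∧
      (Integrable (fun ω => X ω * G (X ω)) P ∧
        ∫ ω, X ω * G (X ω) ∂P = ∫ ω, Z ω * G (Z ω) ∂P) ∧
      (Integrable (fun ω => gRV W P X ω ^ 2) P ∧
        ∫ ω, gRV W P X ω ^ 2 ∂P = ∫ ω, gRV W P Z ω ^ 2 ∂P) := by
  have key : ∀ F : Lp ℝ 2 P, AEMeasurable F P ∧ (∀ f : ℝ → ℝ, Measurable f →
      (Integrable f (P.map F) ↔ Integrable (fun ω => f (F ω)) P) ∧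
      ∫ x, f x ∂(P.map F) = ∫ ω, f (F ω) ∂P) := by
    intro F
    have hm : AEMeasurable F P := (Lp.aestronglyMeasurable F).aemeasurable
    exact ⟨hm, fun f hf => ⟨integrable_map_measure hf.aestronglyMeasurable hm,
      integral_map hm hf.aestronglyMeasurable⟩⟩
  have hi : ∀ F : Lp ℝ 2 P, Integrable id (P.map F) := fun F =>
    ((key F).2 id measurable_id).1.2 ((Lp.memLp F).integrable one_le_two)
  have h2 : ∀ F : Lp ℝ 2 P, Integrable (fun x => x ^ 2) (P.map F) := fun F =>
    ((key F).2 _ (by fun_prop)).1.2 (Lp.memLp F).integrable_sq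
  have h0 : ∀ F : Lp ℝ 2 P, ∫ ω, F ω ∂P = 0 → ∫ x, x ∂(P.map F) = 0 := fun F hF =>
    ((key F).2 id measurable_id).2.trans hF
  have : IsProbabilityMeasure (P.map X) := Measure.isProbabilityMeasure_map (key X).1
  have : IsProbabilityMeasure (P.map Z) := Measure.isProbabilityMeasure_map (key Z).1
  obtain ⟨γ, hγ, hγX⟩ := exists_isSteinKernel hW hX hX0
  obtain ⟨γ', hγ', hγZ⟩ := exists_isSteinKernel hW hZ hZ0
  have mg := (hlaw.measurable_gStar (hi Z) (h0 Z hZ0)).pow_const 2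
  have mG : Measurable fun x => x * G x := measurable_id.mul hG.continuous.measurable
  have mγ := hγ.measurable.pow_const 2
  have mγ' := hγ'.measurable.pow_const 2
  have e1 : (fun ω => gRV W P X ω ^ 2) =ᵐ[P] fun ω => γ (X ω) ^ 2 := by
    filter_upwards [hγX] with ω h; rw [h]; rfl
  have e2 : (fun ω => gRV W P Z ω ^ 2) =ᵐ[P] fun ω => γ' (Z ω) ^ 2 := by
    filter_upwards [hγZ] with ω h; rw [h]; rfl
  rw [hlaw.eq_iff (hi Z) (h0 Z hZ0) hγ' (hi X) (h0 X hX0) (h2 X) hγ hX1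
    (((key Z).2 _ mg).1.2 hfin) hG, integrable_congr e1, integral_congr_ae e1, integral_congr_ae e2,
    ((key X).2 _ mg).1, ((key X).2 _ mG).1, ((key X).2 _ mγ).1, ((key X).2 _ mg).2,
    ((key X).2 _ mG).2, ((key X).2 _ mγ).2, ((key Z).2 _ mg).2, ((key Z).2 _ mG).2,
    ((key Z).2 _ mγ').2]
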